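/- All structures are classical. A rounded ideal of a poset $(S,\le)$ with a relation $\prec$ is a downward closed, inhabited, upward directed subset $I$ with $a\in I\iff\exists b\,(a\prec b\ \&\ b\in I)$; a rounded upper set is an upward closed $U$ with $a\in U\iff\exists b\,(b\prec a\ \&\ b\in U)$. A \emph{proximity poset} is a poset $(S,\le)$ with a relation $\prec$ such that for every $a\in S$ the set $\{b\mid b\prec a\}$ is a rounded ideal and $\{b\mid a\prec b\}$ is a rounded upper set. An \emph{approximable relation} $r\colon S\to S'$ is a relation $r\subseteq S\times S'$ such that $\{a\mid a\mathrel r b\}$ is a rounded ideal for every $b\in S'$ and $\{b\mid a\mathrel r b\}$ is a rounded upper set for every $a\in S$. $\mathsf{PxPos}$ is the category of proximity posets and approximable relations, with $\prec$ as the identity on $S$ and relational composition. A \emph{strong proximity $\vee$-semilattice} is a proximity poset whose poset is a $\vee$-semilattice with least element $0$, such that $a\prec 0$ implies $a=0$, and $a\prec b\vee c$ implies that there are $b'\prec b$, $c'\prec c$ with $a\le b'\vee c'$. It is \emph{localized} if $a\prec b\le c\vee d$ implies that there are $a_1,a_2$ with $a_1\prec b$, $a_1\prec c$, $a_2\prec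 b$, $a_2\prec d$ and $a\prec a_1\vee a_2$. A \emph{proximity relation} between localized strong proximity $\vee$-semilattices is an approximable relation $r\colon S\to S'$ such that (i) $a\mathrel r 0'$ implies $a=0$; (ii) $a\mathrel r(b\vee' c)$ implies that there are $b',c'\in S$ with $a\le b'\vee c'$, $b'\mathrel r b$, $c'\mathrel r c$; (iii) $a\prec a'$ implies $a\mathrel r b$ for some $b$; (iv) $a\prec a'$, $a'\mathrel r b$ and $a'\mathrel r c$ imply that there is $d$ with $d\prec' b$, $d\prec' c$ and $a\mathrel r d$. $\mathsf{LSPxJLat}$ is the category of localized strong proximity $\vee$-semilattices and proximity relations, with the same identities and composition as $\mathsf{PxPos}$. For a relation $r\subseteq S\times S'$ and finite sets $A\subseteq S$, $B\subseteq S'$ put $A\mathrel{r_L}B\iff\forall a\in A\,\exists b\in B\,(a\mathrel r b)$ and $A\mathrel{r_U}B\iff\forall b\in B\,\exists a\in A\,(a\mathrel r b)$. The \emph{lower powerlocale} comonad $\mathrm{P_L}$ on $\mathsf{PxPos}$ sends $S$ to the poset reflection of the finite subsets of $S$ preordered by $\le_L$, with the relation $\prec_L$, and sends $r$ to $r_L$;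 its counit and comultiplication are $A\mathrel{\varepsilon}a\iff A\prec_L\{a\}$ and $A\mathrel{\nu}\mathcal U\iff A\prec_L\bigcup\mathcal U$. The \emph{upper powerlocale} comonad $\mathrm{P_U}$ is defined in the same way with $U$ in place of $L$. For a finite set $\mathcal V$ of finite sets let $\mathcal V^{*}$ be the set of all $B\subseteq\bigcup\mathcal V$ that meet every member of $\mathcal V$. Then $\mathcal U\mathrel{\sigma_S}\mathcal V\iff\mathcal U\mathrel{(\prec_L)_U}\mathcal V^{*}$ defines a distributive law $\sigma\colon\mathrm{P_U}\circ\mathrm{P_L}\to\mathrm{P_L}\circ\mathrm{P_U}$ of comonads, and the \emph{double powerlocale} is the resulting composite comonad $\mathrm{P_U}\circ\mathrm{P_L}$, with counit $\varepsilon^U\circ\mathrm{P_U}\varepsilon^L$ and comultiplication $\mathrm{P_U}\sigma\mathrm{P_L}\circ\nu^U\mathrm{P_L P_L}\circ\mathrm{P_U}\nu^L$. \textbf{Theorem.} The category $\mathsf{LSPxJLat}$ is equivalent to the category of (Eilenberg--Moore) coalgebras of the double powerlocale on $\mathsf{PxPos}$ and coalgebra homomorphisms. Moreover, a strong proximity $\vee$-semilattice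 $S$ is localized if and only if there is a coalgebra structure $S\to\mathrm{P_U}\mathrm{P_L}S$ of the double powerlocale on the underlying proximity poset of $S$. -/

import Mathlib

open CategoryTheory

universe v u

namespace Prox

/-! ### Proximity posets and approximable relations -/

section Basic

/-- An ideal (downward closed, upward directed, inhabited subset) that is rounded with respect
to `prec`. -/
def IsRoundedIdeal {S : Type u} [PartialOrder S] (prec : S → S → Prop) (I : Set S) : Prop :=
  Order.IsIdeal I ∧ ∀ a, a ∈ I ↔ ∃ b, prec a b ∧ b ∈ I

/-- An upward closed subset that is rounded with respect to `prec`. -/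
def IsRoundedUpper {S : Type u} [PartialOrder S] (prec : S → S → Prop) (U : Set S) : Prop :=
  IsUpperSet U ∧ ∀ a, a ∈ U ↔ ∃ b, prec b a ∧ b ∈ U

/-- The structure of a proximity poset on a poset `S`. -/
class Proximity (S : Type u) [PartialOrder S] where
  prec : S → S → Prop
  prec_ideal : ∀ a, IsRoundedIdeal prec {b | prec b a}
  prec_upper : ∀ a, IsRoundedUpper prec {b | prec a b}

infix:50 " ≺ " => Proximity.prec

/-- Approximable relations between proximity posets. -/
@[ext]
structure ApproxRel (S T : Type u) [PartialOrder S] [Proximity S]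
    [PartialOrder T] [Proximity T] where
  rel : S → T → Prop
  ideal : ∀ b, IsRoundedIdeal (Proximity.prec (S := S)) {a | rel a b}
  upper : ∀ a, IsRoundedUpper (Proximity.prec (S := T)) {b | rel a b}

namespace ApproxRel

variable {S T R : Type u} [PartialOrder S] [Proximity S] [PartialOrder T] [Proximity T]
  [PartialOrder R] [Proximity R]

theorem down (r : ApproxRel S T) {a a' : S} {b : T} (h : a ≤ a') (hr : r.rel a' b) :
    r.rel a b := (r.ideal b).1.IsLowerSet h hr

theorem up (r : ApproxRel S T) {a : S} {b b' : T} (hr : r.rel a b) (h : b ≤ b') :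
    r.rel a b' := (r.upper a).1 h hr

theorem inhabited (r : ApproxRel S T) (b : T) : ∃ a, r.rel a b := (r.ideal b).1.Nonempty

theorem directed (r : ApproxRel S T) {a a' : S} {b : T} (h : r.rel a b) (h' : r.rel a' b) :
    ∃ c, r.rel c b ∧ a ≤ c ∧ a' ≤ c := (r.ideal b).1.Directed a h a' h'

theorem left (r : ApproxRel S T) {a : S} {b : T} : r.rel a b ↔ ∃ a', a ≺ a' ∧ r.rel a' b :=
  (r.ideal b).2 a

theorem right (r : ApproxRel S T) {a : S} {b : T} : r.rel a b ↔ ∃ b', b' ≺ b ∧ r.rel a b' :=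
  (r.upper a).2 b

/-- The identity approximable relation is the relation `≺`. -/
def id (S : Type u) [PartialOrder S] [Proximity S] : ApproxRel S S where
  rel := Proximity.prec
  ideal := Proximity.prec_ideal
  upper := Proximity.prec_upper

/-- Relational composition (first `r`, then `s`). -/
def comp (r : ApproxRel S T) (s : ApproxRel T R) : ApproxRel S R where
  rel a c := ∃ b, r.rel a b ∧ s.rel b c
  ideal c := by
    refine ⟨⟨?_, ?_, ?_⟩, ?_⟩
    · rintro a a' h ⟨b, h1, h2⟩
      exact ⟨b, r.down h h1, h2⟩
    · obtain ⟨b, hb⟩ := s.inhabited c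
      obtain ⟨a, ha⟩ := r.inhabited b
      exact ⟨a, b, ha, hb⟩
    · rintro a ⟨b, h1, h2⟩ a' ⟨b', h1', h2'⟩
      obtain ⟨d, hd, h3, h4⟩ := s.directed h2 h2'
      obtain ⟨e, he, h5, h6⟩ := r.directed (r.up h1 h3) (r.up h1' h4)
      exact ⟨e, ⟨d, he, hd⟩, h5, h6⟩
    · intro a
      constructor
      · rintro ⟨b, h1, h2⟩
        obtain ⟨a', h3, h4⟩ := r.left.1 h1
        exact ⟨a', h3, b, h4, h2⟩
      · rintro ⟨a', h3, b, h4, h2⟩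
        exact ⟨b, r.left.2 ⟨a', h3, h4⟩, h2⟩
  upper a := by
    refine ⟨?_, ?_⟩
    · rintro c c' h ⟨b, h1, h2⟩
      exact ⟨b, h1, s.up h2 h⟩
    · intro c
      constructor
      · rintro ⟨b, h1, h2⟩
        obtain ⟨c', h3, h4⟩ := s.right.1 h2
        exact ⟨c', h3, b, h1, h4⟩
      · rintro ⟨c', h3, b, h4, h2⟩
        exact ⟨b, h4, s.right.2 ⟨c', h3, h2⟩⟩

/-- Finitely many elements of a rounded ideal have a strict bound in the ideal. -/
theorem exists_bound (r : ApproxRel S T) (b : T) (A : Finset S) (h : ∀ a ∈ A, r.rel a b) :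
    ∃ c, r.rel c b ∧ ∀ a ∈ A, a ≺ c := by
  classical
  induction A using Finset.induction_on with
  | empty =>
    obtain ⟨c, hc⟩ := r.inhabited b
    exact ⟨c, hc, by simp⟩
  | insert x A _ ih =>
    obtain ⟨c, hc, hA⟩ := ih fun a ha => h a (Finset.mem_insert_of_mem ha)
    obtain ⟨x', hx, hx'⟩ := r.left.1 (h x (Finset.mem_insert_self _ _))
    obtain ⟨d, hd, h1, h2⟩ := r.directed hc hx'
    refine ⟨d, hd, fun a ha => ?_⟩
    rcases Finset.mem_insert.1 ha with rfl | ha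
    · exact (id S).up hx h2
    · exact (id S).up (hA a ha) h1

end ApproxRel

variable {S T R : Type u} [PartialOrder S] [Proximity S] [PartialOrder T] [Proximity T]
  [PartialOrder R] [Proximity R]

theorem prec_trans {a b c : S} (h : a ≺ b) (h' : b ≺ c) : a ≺ c :=
  (ApproxRel.id S).left.2 ⟨b, h, h'⟩

theorem prec_interp {a c : S} (h : a ≺ c) : ∃ b, a ≺ b ∧ b ≺ c :=
  (ApproxRel.id S).left.1 h

theorem le_prec {a b c : S} (h : a ≤ b) (h' : b ≺ c) : a ≺ c := (ApproxRel.id S).down h h'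

theorem prec_le {a b c : S} (h : a ≺ b) (h' : b ≤ c) : a ≺ c := (ApproxRel.id S).up h h'

/-- The conditions on a function `h` which ensure that `a ≺ h b` is an approximable relation. -/
structure ProxMap (h : T → S) : Prop where
  mono : Monotone h
  prec : ∀ {b b'}, b ≺ b' → h b ≺ h b'
  cont : ∀ {a b}, a ≺ h b → ∃ b', b' ≺ b ∧ a ≺ h b'

/-- The approximable relation `a ≺ h b`. -/
def ApproxRel.ofMap (h : T → S) (hh : ProxMap h) : ApproxRel S T where
  rel a b := a ≺ h b
  ideal b := Proximity.prec_ideal (h b)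
  upper a := by
    refine ⟨fun b b' hb hab => prec_le hab (hh.mono hb), fun b => ⟨fun hab => hh.cont hab, ?_⟩⟩
    rintro ⟨b', hb, hab⟩
    exact prec_trans hab (hh.prec hb)

namespace ApproxRel

theorem ext_iff_rel {r s : ApproxRel S T} (h : ∀ a b, r.rel a b ↔ s.rel a b) : r = s :=
  ApproxRel.ext (funext fun a => funext fun b => propext (h a b))

theorem comp_rel {r : ApproxRel S T} {s : ApproxRel T R} {a : S} {c : R} :
    (r.comp s).rel a c ↔ ∃ b, r.rel a b ∧ s.rel b c := Iff.rfl

theorem ofMap_rel {h : T → S} {hh : ProxMap h} {a : S} {b : T} :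
    (ofMap h hh).rel a b ↔ a ≺ h b := Iff.rfl

theorem comp_ofMap_rel {r : ApproxRel S T} {h : R → T} {hh : ProxMap h} {a : S} {b : R} :
    (r.comp (ofMap h hh)).rel a b ↔ r.rel a (h b) := by
  rw [comp_rel, r.right]
  exact ⟨fun ⟨c, h, h'⟩ => ⟨c, h', h⟩, fun ⟨c, h, h'⟩ => ⟨c, h', h⟩⟩

end ApproxRel

end Basic

/-- The objects of `PxPos`: proximity posets. -/
structure PxPos : Type (u + 1) where
  carrier : Type u
  [order : PartialOrder carrier]
  [prox : Proximity carrier]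

attribute [instance] PxPos.order PxPos.prox

/-- The category `PxPos` of proximity posets and approximable relations. -/
instance : Category PxPos.{u} where
  Hom S T := ApproxRel S.carrier T.carrier
  id S := ApproxRel.id S.carrier
  comp r s := r.comp s
  id_comp r := by
    ext a b
    exact r.left.symm
  comp_id r := by
    ext a b
    refine Iff.trans ?_ r.right.symm
    exact ⟨fun ⟨c, h, h'⟩ => ⟨c, h', h⟩, fun ⟨c, h, h'⟩ => ⟨c, h', h⟩⟩
  assoc r s t := by
    ext a b
    constructor
    · rintro ⟨c, ⟨d, h1, h2⟩, h3⟩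
      exact ⟨d, h1, c, h2, h3⟩
    · rintro ⟨d, h1, c, h2, h3⟩
      exact ⟨c, ⟨d, h1, h2⟩, h3⟩

/-! ### Finite subsets -/

section Finite

/-- The lower extension `r_L` of a relation. -/
def lowerExt {S : Type u} {T : Type v} (r : S → T → Prop) (A : Finset S) (B : Finset T) : Prop :=
  ∀ a ∈ A, ∃ b ∈ B, r a b

/-- The upper extension `r_U` of a relation. -/
def upperExt {S : Type u} {T : Type v} (r : S → T → Prop) (A : Finset S) (B : Finset T) : Prop :=
  ∀ b ∈ B, ∃ a ∈ A, r a b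

open Classical in
/-- The finite set `𝒰*`: its elements are the unions of inhabited finite subsets, one chosen from
each member of `𝒰`; equivalently the subsets of `⋃ 𝒰` that meet each member of `𝒰`. The lemmas
`star_empty` and `star_insert` are the usual recursive description. -/
noncomputable def star {S : Type u} (U : Finset (Finset S)) : Finset (Finset S) :=
  (U.biUnion _root_.id).powerset.filter fun B => ∀ A ∈ U, ∃ a ∈ A, a ∈ B

theorem mem_star {S : Type u} {U : Finset (Finset S)} {B : Finset S} :
    B ∈ star U ↔ (∀ b ∈ B, ∃ A ∈ U, b ∈ A) ∧ ∀ A ∈ U, ∃ a ∈ A, a ∈ B := by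
  classical
  simp [star, Finset.subset_iff]

theorem star_empty {S : Type u} : star (∅ : Finset (Finset S)) = {∅} := by
  classical
  ext B
  simp [mem_star, Finset.eq_empty_iff_forall_notMem]

open Classical in
theorem star_insert {S : Type u} (U : Finset (Finset S)) (A : Finset S) :
    star (insert A U) = Finset.image₂ (· ∪ ·) (star U) (A.powerset.filter Finset.Nonempty) := by
  ext B
  simp only [mem_star, Finset.mem_image₂, Finset.mem_filter, Finset.mem_powerset]
  constructor
  · rintro ⟨h1, h2⟩
    refine ⟨B.filter fun b => ∃ A' ∈ U, b ∈ A', ⟨fun b hb => (Finset.mem_filter.1 hb).2, ?_⟩,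
      B.filter (· ∈ A), ⟨fun b hb => (Finset.mem_filter.1 hb).2, ?_⟩, ?_⟩
    · intro A' hA'
      obtain ⟨a, ha, hb⟩ := h2 A' (Finset.mem_insert_of_mem hA')
      exact ⟨a, ha, Finset.mem_filter.2 ⟨hb, A', hA', ha⟩⟩
    · obtain ⟨a, ha, hb⟩ := h2 A (Finset.mem_insert_self _ _)
      exact ⟨a, Finset.mem_filter.2 ⟨hb, ha⟩⟩
    · ext b
      simp only [Finset.mem_union, Finset.mem_filter]
      constructor
      · rintro (h | h) <;> exact h.1
      · intro hb
        obtain ⟨A', hA', hbA⟩ := h1 b hb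
        rcases Finset.mem_insert.1 hA' with rfl | h
        · exact Or.inr ⟨hb, hbA⟩
        · exact Or.inl ⟨hb, A', h, hbA⟩
  · rintro ⟨B', ⟨h1, h2⟩, C, ⟨h3, ⟨c, hc⟩⟩, rfl⟩
    constructor
    · intro b hb
      rcases Finset.mem_union.1 hb with hb | hb
      · obtain ⟨A', hA', h⟩ := h1 b hb
        exact ⟨A', Finset.mem_insert_of_mem hA', h⟩
      · exact ⟨A, Finset.mem_insert_self _ _, h3 hb⟩
    · intro A' hA'
      rcases Finset.mem_insert.1 hA' with rfl | h
      · exact ⟨c, h3 hc, Finset.mem_union_right _ hc⟩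
      · obtain ⟨a, ha, hb⟩ := h2 A' h
        exact ⟨a, ha, Finset.mem_union_left _ hb⟩

theorem exists_star_subset {S : Type u} {U : Finset (Finset S)} {B : Finset S}
    (h : ∀ A ∈ U, ∃ a ∈ A, a ∈ B) : ∃ C ∈ star U, C ⊆ B := by
  classical
  refine ⟨B.filter fun b => ∃ A ∈ U, b ∈ A, mem_star.2 ⟨?_, ?_⟩, Finset.filter_subset _ _⟩
  · intro b hb
    exact (Finset.mem_filter.1 hb).2
  · intro A hA
    obtain ⟨a, ha, hb⟩ := h A hA
    exact ⟨a, ha, Finset.mem_filter.2 ⟨hb, A, hA, ha⟩⟩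

theorem exists_finset_choice {α : Type u} {β : Type v} {P : α → β → Prop} (A : Finset α)
    (h : ∀ a ∈ A, ∃ b, P a b) :
    ∃ B : Finset β, (∀ a ∈ A, ∃ b ∈ B, P a b) ∧ ∀ b ∈ B, ∃ a ∈ A, P a b := by
  classical
  choose f hf using fun a : A => h a a.2
  refine ⟨A.attach.image f, fun a ha => ⟨f ⟨a, ha⟩, ?_, hf ⟨a, ha⟩⟩, ?_⟩
  · exact Finset.mem_image_of_mem _ (Finset.mem_attach _ _)
  · intro b hb
    obtain ⟨a, _, rfl⟩ := Finset.mem_image.1 hb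
    exact ⟨a, a.2, hf a⟩

end Finite

/-- Relations compatible with the orders: `a' ≤ a r b ≤ b'` implies `a' r b'`. -/
def IsMonoRel {S T : Type u} [PartialOrder S] [PartialOrder T] (r : S → T → Prop) : Prop :=
  ∀ ⦃a a' b b'⦄, a' ≤ a → r a b → b ≤ b' → r a' b'

theorem ApproxRel.isMonoRel {S T : Type u} [PartialOrder S] [Proximity S] [PartialOrder T]
    [Proximity T] (r : ApproxRel S T) : IsMonoRel r.rel :=
  fun _ _ _ _ h hr h' => r.up (r.down h hr) h'

/-! ### The lower powerlocale -/

/-- Finite subsets of `S`, preordered by `≤_L`. -/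
def LowerFin (S : Type u) : Type u := Finset S

instance (S : Type u) [PartialOrder S] : Preorder (LowerFin S) where
  le := lowerExt (S := S) (T := S) (· ≤ ·)
  le_refl _ a ha := ⟨a, ha, le_rfl⟩
  le_trans A B C h h' a ha := by
    obtain ⟨b, hb, hab⟩ := h a ha
    obtain ⟨c, hc, hbc⟩ := h' b hb
    exact ⟨c, hc, hab.trans hbc⟩

/-- The poset reflection of the preorder `≤_L` on the finite subsets of `S`. -/
def Lower (S : Type u) [PartialOrder S] : Type u := Antisymmetrization (LowerFin S) (· ≤ ·)

namespace Lower

instance (S : Type u) [PartialOrder S] : PartialOrder (Lower S) :=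
  inferInstanceAs (PartialOrder (Antisymmetrization (LowerFin S) (· ≤ ·)))

section Order

variable {S T : Type u} [PartialOrder S] [PartialOrder T]

/-- The class of a finite subset. -/
def mk (A : Finset S) : Lower S := toAntisymmetrization (α := LowerFin S) (· ≤ ·) A

/-- A representative of a class. -/
noncomputable def rep (X : Lower S) : Finset S :=
  ofAntisymmetrization (α := LowerFin S) (· ≤ ·) X

theorem mk_rep (X : Lower S) : mk (rep X) = X :=
  toAntisymmetrization_ofAntisymmetrization (α := LowerFin S) (· ≤ ·) X

theorem mk_le_mk {A B : Finset S} : mk A ≤ mk B ↔ lowerExt (· ≤ ·) A B :=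
  toAntisymmetrization_le_toAntisymmetrization_iff (α := LowerFin S)

/-- The relation induced on classes by the lower extension of `r`. -/
def rel (r : S → T → Prop) : Lower S → Lower T → Prop := Relation.Map (lowerExt r) mk mk

/-- `a` lies below the class `X`. -/
def Mem (a : S) (X : Lower S) : Prop := mk {a} ≤ X

theorem mem_mk {a : S} {A : Finset S} : Mem a (mk A) ↔ ∃ b ∈ A, a ≤ b := by
  simp [Mem, mk_le_mk, lowerExt]

theorem mem_iff {a : S} {X : Lower S} : Mem a X ↔ ∃ b ∈ rep X, a ≤ b := by
  rw [← mem_mk, mk_rep]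

theorem mem_of_rep {a : S} {X : Lower S} (h : a ∈ rep X) : Mem a X := mem_iff.2 ⟨a, h, le_rfl⟩

theorem mem_mk_of {a : S} {A : Finset S} (h : a ∈ A) : Mem a (mk A) := mem_mk.2 ⟨a, h, le_rfl⟩

theorem Mem.down {a b : S} {X : Lower S} (h : a ≤ b) (hb : Mem b X) : Mem a X := by
  obtain ⟨c, hc, h'⟩ := mem_iff.1 hb
  exact mem_iff.2 ⟨c, hc, h.trans h'⟩

theorem le_iff {X Y : Lower S} : X ≤ Y ↔ ∀ a, Mem a X → Mem a Y := by
  constructor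
  · intro h a ha
    exact le_trans ha h
  · intro h
    rw [← mk_rep X, ← mk_rep Y, mk_le_mk]
    intro a ha
    exact mem_iff.1 (h a (mem_of_rep ha))

theorem ext_mem {X Y : Lower S} (h : ∀ a, Mem a X ↔ Mem a Y) : X = Y :=
  le_antisymm (le_iff.2 fun a => (h a).1) (le_iff.2 fun a => (h a).2)

theorem mem_sing {a b : S} : Mem a (mk {b}) ↔ a ≤ b := by simp [mem_mk]

theorem rel_iff {r : S → T → Prop} (hr : IsMonoRel r) {X : Lower S} {Y : Lower T} :
    rel r X Y ↔ ∀ a, Mem a X → ∃ b, Mem b Y ∧ r a b := by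
  constructor
  · rintro ⟨A, B, h, rfl, rfl⟩ a ha
    obtain ⟨a', ha', hle⟩ := mem_mk.1 ha
    obtain ⟨b, hb, hab⟩ := h a' ha'
    exact ⟨b, mem_mk_of hb, hr hle hab le_rfl⟩
  · intro h
    refine ⟨rep X, rep Y, fun a ha => ?_, mk_rep X, mk_rep Y⟩
    obtain ⟨b, hb, hab⟩ := h a (mem_of_rep ha)
    obtain ⟨c, hc, hbc⟩ := mem_iff.1 hb
    exact ⟨c, hc, hr le_rfl hab hbc⟩

theorem rel_mk {r : S → T → Prop} (hr : IsMonoRel r) {A : Finset S} {B : Finset T} :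
    rel r (mk A) (mk B) ↔ lowerExt r A B := by
  rw [rel_iff hr]
  constructor
  · intro h a ha
    obtain ⟨b, hb, hab⟩ := h a (mem_mk_of ha)
    obtain ⟨c, hc, hbc⟩ := mem_mk.1 hb
    exact ⟨c, hc, hr le_rfl hab hbc⟩
  · intro h a ha
    obtain ⟨a', ha', hle⟩ := mem_mk.1 ha
    obtain ⟨b, hb, hab⟩ := h a' ha'
    exact ⟨b, mem_mk_of hb, hr hle hab le_rfl⟩

open Classical in
/-- The class of the union of a finite set of classes. -/
noncomputable def join (X : Lower (Lower S)) : Lower S := mk ((rep X).biUnion rep)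

theorem mem_join {a : S} {X : Lower (Lower S)} : Mem a (join X) ↔ ∃ Y, Mem Y X ∧ Mem a Y := by
  classical
  simp only [join, mem_mk, Finset.mem_biUnion]
  constructor
  · rintro ⟨b, ⟨Y, hY, hb⟩, hab⟩
    exact ⟨Y, mem_of_rep hY, mem_iff.2 ⟨b, hb, hab⟩⟩
  · rintro ⟨Y, hY, ha⟩
    obtain ⟨Z, hZ, hYZ⟩ := mem_iff.1 hY
    obtain ⟨b, hb, hab⟩ := mem_iff.1 (le_iff.1 hYZ a ha)
    exact ⟨b, ⟨Z, hZ, hb⟩, hab⟩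

open Classical in
theorem join_mk (U : Finset (Finset S)) : join (mk (U.image mk)) = mk (U.biUnion _root_.id) := by
  refine ext_mem fun a => ?_
  simp only [mem_join, mem_mk, Finset.mem_image, Finset.mem_biUnion, id_eq]
  constructor
  · rintro ⟨Y, ⟨_, ⟨A, hA, rfl⟩, hYA⟩, ha⟩
    obtain ⟨b, hb, hab⟩ := mem_mk.1 (le_iff.1 hYA a ha)
    exact ⟨b, ⟨A, hA, hb⟩, hab⟩
  · rintro ⟨b, ⟨A, hA, hb⟩, hab⟩
    exact ⟨mk A, ⟨mk A, ⟨A, hA, rfl⟩, le_rfl⟩, mem_mk.2 ⟨b, hb, hab⟩⟩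

open Classical in
/-- The image of a class under a function. -/
noncomputable def fmap (h : S → T) (X : Lower S) : Lower T := mk ((rep X).image h)

theorem mem_fmap {h : S → T} (hh : Monotone h) {X : Lower S} {b : T} :
    Mem b (fmap h X) ↔ ∃ a, Mem a X ∧ b ≤ h a := by
  classical
  simp only [fmap, mem_mk, Finset.mem_image]
  constructor
  · rintro ⟨_, ⟨a, ha, rfl⟩, hb⟩
    exact ⟨a, mem_of_rep ha, hb⟩
  · rintro ⟨a, ha, hb⟩
    obtain ⟨c, hc, hac⟩ := mem_iff.1 ha
    exact ⟨h c, ⟨c, hc, rfl⟩, hb.trans (hh hac)⟩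

theorem sing_mono : Monotone fun a : S => mk {a} := by
  intro a b h
  exact mem_sing.2 h

theorem join_mono : Monotone (join (S := S)) := by
  intro X Y h
  refine le_iff.2 fun a ha => ?_
  obtain ⟨Z, hZ, haZ⟩ := mem_join.1 ha
  exact mem_join.2 ⟨Z, le_iff.1 h Z hZ, haZ⟩

end Order

section Prox

variable {S T R : Type u} [PartialOrder S] [Proximity S] [PartialOrder T] [Proximity T]
  [PartialOrder R] [Proximity R]

theorem rel_ideal (r : ApproxRel S T) (Y : Lower T) :
    IsRoundedIdeal (rel (Proximity.prec (S := S))) {X | rel r.rel X Y} := by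
  classical
  have hp := (ApproxRel.id S).isMonoRel
  have hr := r.isMonoRel
  refine ⟨⟨?_, ?_, ?_⟩, ?_⟩
  · intro X X' h hX
    exact (rel_iff hr).2 fun a ha => (rel_iff hr).1 hX a (le_iff.1 h a ha)
  · exact ⟨mk ∅, (rel_iff hr).2 fun a ha => by simp [mem_mk] at ha⟩
  · intro X hX X' hX'
    refine ⟨mk (rep X ∪ rep X'), (rel_iff hr).2 fun a ha => ?_, le_iff.2 fun a ha => ?_,
      le_iff.2 fun a ha => ?_⟩
    · obtain ⟨b, hb, hab⟩ := mem_mk.1 ha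
      rcases Finset.mem_union.1 hb with hb | hb
      · exact (rel_iff hr).1 hX a (mem_iff.2 ⟨b, hb, hab⟩)
      · exact (rel_iff hr).1 hX' a (mem_iff.2 ⟨b, hb, hab⟩)
    · obtain ⟨b, hb, hab⟩ := mem_iff.1 ha
      exact mem_mk.2 ⟨b, Finset.mem_union_left _ hb, hab⟩
    · obtain ⟨b, hb, hab⟩ := mem_iff.1 ha
      exact mem_mk.2 ⟨b, Finset.mem_union_right _ hb, hab⟩
  · intro X
    constructor
    · intro hX
      have h : ∀ a ∈ rep X, ∃ a', a ≺ a' ∧ ∃ b, Mem b Y ∧ r.rel a' b := by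
        intro a ha
        obtain ⟨b, hb, hab⟩ := (rel_iff hr).1 hX a (mem_of_rep ha)
        obtain ⟨a', h1, h2⟩ := r.left.1 hab
        exact ⟨a', h1, b, hb, h2⟩
      obtain ⟨B, hB, hB'⟩ := exists_finset_choice _ h
      refine ⟨mk B, (rel_iff hp).2 fun a ha => ?_, (rel_iff hr).2 fun a ha => ?_⟩
      · obtain ⟨c, hc, hac⟩ := mem_iff.1 ha
        obtain ⟨b, hb, hcb, -⟩ := hB c hc
        exact ⟨b, mem_mk_of hb, le_prec hac hcb⟩
      · obtain ⟨c, hc, hac⟩ := mem_mk.1 ha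
        obtain ⟨_, _, _, b, hb, hcb⟩ := hB' c hc
        exact ⟨b, hb, r.down hac hcb⟩
    · rintro ⟨X', h, h'⟩
      refine (rel_iff hr).2 fun a ha => ?_
      obtain ⟨a', ha', haa⟩ := (rel_iff hp).1 h a ha
      obtain ⟨b, hb, hab⟩ := (rel_iff hr).1 h' a' ha'
      exact ⟨b, hb, r.left.2 ⟨a', haa, hab⟩⟩

theorem rel_upper (r : ApproxRel S T) (X : Lower S) :
    IsRoundedUpper (rel (Proximity.prec (S := T))) {Y | rel r.rel X Y} := by
  have hp := (ApproxRel.id T).isMonoRel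
  have hr := r.isMonoRel
  refine ⟨?_, ?_⟩
  · intro Y Y' h hY
    refine (rel_iff hr).2 fun a ha => ?_
    obtain ⟨b, hb, hab⟩ := (rel_iff hr).1 hY a ha
    exact ⟨b, le_iff.1 h b hb, hab⟩
  · intro Y
    constructor
    · intro hY
      have h : ∀ a ∈ rep X, ∃ b', r.rel a b' ∧ ∃ b, Mem b Y ∧ b' ≺ b := by
        intro a ha
        obtain ⟨b, hb, hab⟩ := (rel_iff hr).1 hY a (mem_of_rep ha)
        obtain ⟨b', h1, h2⟩ := r.right.1 hab
        exact ⟨b', h2, b, hb, h1⟩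
      obtain ⟨B, hB, hB'⟩ := exists_finset_choice _ h
      refine ⟨mk B, (rel_iff hp).2 fun b hb => ?_, (rel_iff hr).2 fun a ha => ?_⟩
      · obtain ⟨c, hc, hbc⟩ := mem_mk.1 hb
        obtain ⟨_, _, _, d, hd, hcd⟩ := hB' c hc
        exact ⟨d, hd, le_prec hbc hcd⟩
      · obtain ⟨c, hc, hac⟩ := mem_iff.1 ha
        obtain ⟨b, hb, hcb, -⟩ := hB c hc
        exact ⟨b, mem_mk_of hb, r.down hac hcb⟩
    · rintro ⟨Y', h, h'⟩
      refine (rel_iff hr).2 fun a ha => ?_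
      obtain ⟨b', hb', hab⟩ := (rel_iff hr).1 h' a ha
      obtain ⟨b, hb, hbb⟩ := (rel_iff hp).1 h b' hb'
      exact ⟨b, hb, r.right.2 ⟨b', hbb, hab⟩⟩

/-- The proximity `≺_L` on the lower powerlocale. -/
instance : Proximity (Lower S) where
  prec := rel Proximity.prec
  prec_ideal := rel_ideal (ApproxRel.id S)
  prec_upper := rel_upper (ApproxRel.id S)

/-- The action of the lower powerlocale on approximable relations: `r ↦ r_L`. -/
def map (r : ApproxRel S T) : ApproxRel (Lower S) (Lower T) where
  rel := rel r.rel
  ideal := rel_ideal r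
  upper := rel_upper r

theorem prec_iff {X Y : Lower S} : X ≺ Y ↔ ∀ a, Mem a X → ∃ b, Mem b Y ∧ a ≺ b :=
  rel_iff (ApproxRel.id S).isMonoRel

theorem map_iff {r : ApproxRel S T} {X : Lower S} {Y : Lower T} :
    (map r).rel X Y ↔ ∀ a, Mem a X → ∃ b, Mem b Y ∧ r.rel a b := rel_iff r.isMonoRel

theorem map_sing_iff {r : ApproxRel S T} {X : Lower S} {b : T} :
    (map r).rel X (mk {b}) ↔ ∃ a, X ≺ mk {a} ∧ r.rel a b := by
  constructor
  · intro h
    have h' : ∀ a ∈ rep X, r.rel a b := by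
      intro a ha
      obtain ⟨b', hb', hab⟩ := map_iff.1 h a (mem_of_rep ha)
      exact r.up hab (mem_sing.1 hb')
    obtain ⟨c, hc, hX⟩ := r.exists_bound b _ h'
    refine ⟨c, prec_iff.2 fun a ha => ?_, hc⟩
    obtain ⟨d, hd, had⟩ := mem_iff.1 ha
    exact ⟨c, mem_sing.2 le_rfl, le_prec had (hX d hd)⟩
  · rintro ⟨a, h, hab⟩
    refine map_iff.2 fun x hx => ?_
    obtain ⟨y, hy, hxy⟩ := prec_iff.1 h x hx
    exact ⟨b, mem_sing.2 le_rfl, r.left.2 ⟨y, hxy, r.down (mem_sing.1 hy) hab⟩⟩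

theorem sing_proxMap : ProxMap fun a : S => mk {a} where
  mono := sing_mono
  prec := by
    intro b b' h
    refine prec_iff.2 fun a ha => ⟨b', mem_sing.2 le_rfl, le_prec (mem_sing.1 ha) h⟩
  cont := by
    intro X b h
    obtain ⟨a, h1, h2⟩ := (map_sing_iff (r := ApproxRel.id S)).1 h
    exact ⟨a, h2, h1⟩

theorem map_join_iff {r : ApproxRel S T} {X : Lower S} {Y : Lower (Lower T)} :
    (map r).rel X (join Y) ↔ ∃ U, X ≺ join U ∧ (map (map r)).rel U Y := by
  classical
  constructor
  · intro h
    have h' : ∀ a ∈ rep X, ∃ a', a ≺ a' ∧ ∃ Z, Mem Z Y ∧ ∃ b, Mem b Z ∧ r.rel a' b := by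
      intro a ha
      obtain ⟨b, hb, hab⟩ := map_iff.1 h a (mem_of_rep ha)
      obtain ⟨Z, hZ, hbZ⟩ := mem_join.1 hb
      obtain ⟨a', h1, h2⟩ := r.left.1 hab
      exact ⟨a', h1, Z, hZ, b, hbZ, h2⟩
    obtain ⟨B, hB, hB'⟩ := exists_finset_choice _ h'
    refine ⟨mk (B.image fun b => mk {b}), prec_iff.2 fun a ha => ?_, map_iff.2 fun V hV => ?_⟩
    · obtain ⟨c, hc, hac⟩ := mem_iff.1 ha
      obtain ⟨b, hb, hcb, -⟩ := hB c hc
      exact ⟨b, mem_join.2 ⟨mk {b}, mem_mk_of (Finset.mem_image_of_mem _ hb), mem_sing.2 le_rfl⟩,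
        le_prec hac hcb⟩
    · obtain ⟨_, hW, hVW⟩ := mem_mk.1 hV
      obtain ⟨b, hb, rfl⟩ := Finset.mem_image.1 hW
      obtain ⟨_, _, _, Z, hZ, c, hc, hbc⟩ := hB' b hb
      refine ⟨Z, hZ, map_iff.2 fun a ha => ⟨c, hc, r.down (mem_sing.1 (le_iff.1 hVW a ha)) hbc⟩⟩
  · rintro ⟨U, h1, h2⟩
    refine map_iff.2 fun a ha => ?_
    obtain ⟨a', ha', haa⟩ := prec_iff.1 h1 a ha
    obtain ⟨V, hV, haV⟩ := mem_join.1 ha'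
    obtain ⟨Z, hZ, hVZ⟩ := map_iff.1 h2 V hV
    obtain ⟨b, hb, hab⟩ := map_iff.1 hVZ a' haV
    exact ⟨b, mem_join.2 ⟨Z, hZ, hb⟩, r.left.2 ⟨a', haa, hab⟩⟩

theorem join_proxMap : ProxMap (join (S := S)) where
  mono := join_mono
  prec := by
    intro X Y h
    refine prec_iff.2 fun a ha => ?_
    obtain ⟨Z, hZ, haZ⟩ := mem_join.1 ha
    obtain ⟨W, hW, hZW⟩ := prec_iff.1 h Z hZ
    obtain ⟨b, hb, hab⟩ := prec_iff.1 hZW a haZ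
    exact ⟨b, mem_join.2 ⟨W, hW, hb⟩, hab⟩
  cont := by
    intro X Y h
    obtain ⟨U, h1, h2⟩ := (map_join_iff (r := ApproxRel.id S)).1 h
    exact ⟨U, h2, h1⟩

theorem map_ofMap_iff {h : T → S} (hh : ProxMap h) {X : Lower S} {Y : Lower T} :
    (map (ApproxRel.ofMap h hh)).rel X Y ↔ X ≺ fmap h Y := by
  rw [map_iff, prec_iff]
  constructor
  · intro H a ha
    obtain ⟨b, hb, hab⟩ := H a ha
    exact ⟨h b, (mem_fmap hh.mono).2 ⟨b, hb, le_rfl⟩, hab⟩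
  · intro H a ha
    obtain ⟨c, hc, hac⟩ := H a ha
    obtain ⟨b, hb, hcb⟩ := (mem_fmap hh.mono).1 hc
    exact ⟨b, hb, prec_le hac hcb⟩

theorem map_comp (r : ApproxRel S T) (s : ApproxRel T R) :
    map (r.comp s) = (map r).comp (map s) := by
  refine ApproxRel.ext_iff_rel fun X Z => ?_
  rw [ApproxRel.comp_rel]
  constructor
  · intro h
    have h' : ∀ a ∈ rep X, ∃ b, r.rel a b ∧ ∃ c, Mem c Z ∧ s.rel b c := by
      intro a ha
      obtain ⟨c, hc, b, hab, hbc⟩ := map_iff.1 h a (mem_of_rep ha)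
      exact ⟨b, hab, c, hc, hbc⟩
    obtain ⟨B, hB, hB'⟩ := exists_finset_choice _ h'
    refine ⟨mk B, map_iff.2 fun a ha => ?_, map_iff.2 fun b hb => ?_⟩
    · obtain ⟨a', ha', haa⟩ := mem_iff.1 ha
      obtain ⟨b, hb, hab, -⟩ := hB a' ha'
      exact ⟨b, mem_mk_of hb, r.down haa hab⟩
    · obtain ⟨b', hb', hbb⟩ := mem_mk.1 hb
      obtain ⟨_, _, _, c, hc, hbc⟩ := hB' b' hb'
      exact ⟨c, hc, s.down hbb hbc⟩
  · rintro ⟨Y, h1, h2⟩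
    refine map_iff.2 fun a ha => ?_
    obtain ⟨b, hb, hab⟩ := map_iff.1 h1 a ha
    obtain ⟨c, hc, hbc⟩ := map_iff.1 h2 b hb
    exact ⟨c, hc, b, hab, hbc⟩

/-- The counit: `X ε a` iff `X ≺_L {a}`. -/
def counit (S : Type u) [PartialOrder S] [Proximity S] : ApproxRel (Lower S) S :=
  ApproxRel.ofMap (fun a => mk {a}) sing_proxMap

/-- The comultiplication: `X ν 𝒰` iff `X ≺_L ⋃ 𝒰`. -/
noncomputable def comult (S : Type u) [PartialOrder S] [Proximity S] :
    ApproxRel (Lower S) (Lower (Lower S)) :=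
  ApproxRel.ofMap join join_proxMap

theorem comp_map_ofMap_rel {r : ApproxRel R (Lower S)} {h : T → S} {hh : ProxMap h} {a : R}
    {b : Lower T} : (r.comp (map (ApproxRel.ofMap h hh))).rel a b ↔ r.rel a (fmap h b) := by
  rw [ApproxRel.comp_rel, ApproxRel.right]
  constructor
  · rintro ⟨c, h1, h2⟩
    exact ⟨c, (map_ofMap_iff hh).1 h2, h1⟩
  · rintro ⟨c, h1, h2⟩
    exact ⟨c, h2, (map_ofMap_iff hh).2 h1⟩

theorem counit_natural (r : ApproxRel S T) :
    (map r).comp (counit T) = (counit S).comp r :=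
  ApproxRel.ext_iff_rel fun _ _ => ApproxRel.comp_ofMap_rel.trans map_sing_iff

theorem comult_natural (r : ApproxRel S T) :
    (map r).comp (comult T) = (comult S).comp (map (map r)) :=
  ApproxRel.ext_iff_rel fun _ _ => ApproxRel.comp_ofMap_rel.trans map_join_iff

theorem coassoc :
    (comult S).comp (map (comult S)) = (comult S).comp (comult (Lower S)) := by
  refine ApproxRel.ext_iff_rel fun X Y => ?_
  refine comp_map_ofMap_rel.trans (Iff.trans ?_ ApproxRel.comp_ofMap_rel.symm)
  refine iff_of_eq (congrArg (fun Z => X ≺ Z) (ext_mem fun a => ?_))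
  simp only [mem_join, mem_fmap join_mono]
  constructor
  · rintro ⟨Z, ⟨W, hW, hZ⟩, ha⟩
    obtain ⟨V, hV, haV⟩ := mem_join.1 (le_iff.1 hZ a ha)
    exact ⟨V, ⟨W, hW, hV⟩, haV⟩
  · rintro ⟨V, ⟨W, hW, hV⟩, haV⟩
    exact ⟨join W, ⟨W, hW, le_rfl⟩, mem_join.2 ⟨V, hV, haV⟩⟩

theorem comult_counit : (comult S).comp (counit (Lower S)) = ApproxRel.id (Lower S) := by
  refine ApproxRel.ext_iff_rel fun X Y => ApproxRel.comp_ofMap_rel.trans ?_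
  refine iff_of_eq (congrArg (fun Z => X ≺ Z) (ext_mem fun a => ?_))
  simp only [mem_join, mem_sing]
  exact ⟨fun ⟨Z, hZ, ha⟩ => le_iff.1 hZ a ha, fun ha => ⟨Y, le_rfl, ha⟩⟩

theorem comult_map_counit : (comult S).comp (map (counit S)) = ApproxRel.id (Lower S) := by
  refine ApproxRel.ext_iff_rel fun X Y => comp_map_ofMap_rel.trans ?_
  refine iff_of_eq (congrArg (fun Z => X ≺ Z) (ext_mem fun a => ?_))
  simp only [mem_join, mem_fmap sing_mono]
  constructor
  · rintro ⟨Z, ⟨b, hb, hZ⟩, ha⟩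
    exact hb.down (mem_sing.1 (le_iff.1 hZ a ha))
  · intro ha
    exact ⟨_, ⟨a, ha, le_rfl⟩, mem_sing.2 le_rfl⟩

end Prox

end Lower

/-! ### The upper powerlocale -/

/-- Finite subsets of `S`, preordered by `≤_U`. -/
def UpperFin (S : Type u) : Type u := Finset S

instance (S : Type u) [PartialOrder S] : Preorder (UpperFin S) where
  le := upperExt (S := S) (T := S) (· ≤ ·)
  le_refl _ a ha := ⟨a, ha, le_rfl⟩
  le_trans A B C h h' c hc := by
    obtain ⟨b, hb, hbc⟩ := h' c hc
    obtain ⟨a, ha, hab⟩ := h b hb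
    exact ⟨a, ha, hab.trans hbc⟩

/-- The poset reflection of the preorder `≤_U` on the finite subsets of `S`. -/
def Upper (S : Type u) [PartialOrder S] : Type u := Antisymmetrization (UpperFin S) (· ≤ ·)

namespace Upper

instance (S : Type u) [PartialOrder S] : PartialOrder (Upper S) :=
  inferInstanceAs (PartialOrder (Antisymmetrization (UpperFin S) (· ≤ ·)))

section Order

variable {S T : Type u} [PartialOrder S] [PartialOrder T]

/-- The class of a finite subset. -/
def mk (A : Finset S) : Upper S := toAntisymmetrization (α := UpperFin S) (· ≤ ·) A

/-- A representative of a class. -/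
noncomputable def rep (X : Upper S) : Finset S :=
  ofAntisymmetrization (α := UpperFin S) (· ≤ ·) X

theorem mk_rep (X : Upper S) : mk (rep X) = X :=
  toAntisymmetrization_ofAntisymmetrization (α := UpperFin S) (· ≤ ·) X

theorem mk_le_mk {A B : Finset S} : mk A ≤ mk B ↔ upperExt (· ≤ ·) A B :=
  toAntisymmetrization_le_toAntisymmetrization_iff (α := UpperFin S)

/-- The relation induced on classes by the upper extension of `r`. -/
def rel (r : S → T → Prop) : Upper S → Upper T → Prop := Relation.Map (upperExt r) mk mk

/-- `a` lies above some element of (a representative of) the class `X`. -/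
def Mem (a : S) (X : Upper S) : Prop := X ≤ mk {a}

theorem mem_mk {a : S} {A : Finset S} : Mem a (mk A) ↔ ∃ b ∈ A, b ≤ a := by
  simp [Mem, mk_le_mk, upperExt]

theorem mem_iff {a : S} {X : Upper S} : Mem a X ↔ ∃ b ∈ rep X, b ≤ a := by
  rw [← mem_mk, mk_rep]

theorem mem_of_rep {a : S} {X : Upper S} (h : a ∈ rep X) : Mem a X := mem_iff.2 ⟨a, h, le_rfl⟩

theorem mem_mk_of {a : S} {A : Finset S} (h : a ∈ A) : Mem a (mk A) := mem_mk.2 ⟨a, h, le_rfl⟩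

theorem Mem.up {a b : S} {X : Upper S} (h : a ≤ b) (ha : Mem a X) : Mem b X := by
  obtain ⟨c, hc, h'⟩ := mem_iff.1 ha
  exact mem_iff.2 ⟨c, hc, h'.trans h⟩

theorem le_iff {X Y : Upper S} : X ≤ Y ↔ ∀ a, Mem a Y → Mem a X := by
  constructor
  · intro h a ha
    exact le_trans h ha
  · intro h
    rw [← mk_rep X, ← mk_rep Y, mk_le_mk]
    intro a ha
    exact mem_iff.1 (h a (mem_of_rep ha))

theorem ext_mem {X Y : Upper S} (h : ∀ a, Mem a X ↔ Mem a Y) : X = Y :=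
  le_antisymm (le_iff.2 fun a => (h a).2) (le_iff.2 fun a => (h a).1)

theorem mem_sing {a b : S} : Mem a (mk {b}) ↔ b ≤ a := by simp [mem_mk]

theorem rel_iff {r : S → T → Prop} (hr : IsMonoRel r) {X : Upper S} {Y : Upper T} :
    rel r X Y ↔ ∀ b, Mem b Y → ∃ a, Mem a X ∧ r a b := by
  constructor
  · rintro ⟨A, B, h, rfl, rfl⟩ b hb
    obtain ⟨b', hb', hle⟩ := mem_mk.1 hb
    obtain ⟨a, ha, hab⟩ := h b' hb'
    exact ⟨a, mem_mk_of ha, hr le_rfl hab hle⟩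
  · intro h
    refine ⟨rep X, rep Y, fun b hb => ?_, mk_rep X, mk_rep Y⟩
    obtain ⟨a, ha, hab⟩ := h b (mem_of_rep hb)
    obtain ⟨c, hc, hca⟩ := mem_iff.1 ha
    exact ⟨c, hc, hr hca hab le_rfl⟩

theorem rel_mk {r : S → T → Prop} (hr : IsMonoRel r) {A : Finset S} {B : Finset T} :
    rel r (mk A) (mk B) ↔ upperExt r A B := by
  rw [rel_iff hr]
  constructor
  · intro h b hb
    obtain ⟨a, ha, hab⟩ := h b (mem_mk_of hb)
    obtain ⟨c, hc, hca⟩ := mem_mk.1 ha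
    exact ⟨c, hc, hr hca hab le_rfl⟩
  · intro h b hb
    obtain ⟨b', hb', hle⟩ := mem_mk.1 hb
    obtain ⟨a, ha, hab⟩ := h b' hb'
    exact ⟨a, mem_mk_of ha, hr le_rfl hab hle⟩

open Classical in
/-- The class of the union of a finite set of classes. -/
noncomputable def join (X : Upper (Upper S)) : Upper S := mk ((rep X).biUnion rep)

theorem mem_join {a : S} {X : Upper (Upper S)} : Mem a (join X) ↔ ∃ Y, Mem Y X ∧ Mem a Y := by
  classical
  simp only [join, mem_mk, Finset.mem_biUnion]
  constructor
  · rintro ⟨b, ⟨Y, hY, hb⟩, hab⟩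
    exact ⟨Y, mem_of_rep hY, mem_iff.2 ⟨b, hb, hab⟩⟩
  · rintro ⟨Y, hY, ha⟩
    obtain ⟨Z, hZ, hYZ⟩ := mem_iff.1 hY
    obtain ⟨b, hb, hab⟩ := mem_iff.1 (le_iff.1 hYZ a ha)
    exact ⟨b, ⟨Z, hZ, hb⟩, hab⟩

open Classical in
theorem join_mk (U : Finset (Finset S)) : join (mk (U.image mk)) = mk (U.biUnion _root_.id) := by
  refine ext_mem fun a => ?_
  simp only [mem_join, mem_mk, Finset.mem_image, Finset.mem_biUnion, id_eq]
  constructor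
  · rintro ⟨Y, ⟨_, ⟨A, hA, rfl⟩, hYA⟩, ha⟩
    obtain ⟨b, hb, hab⟩ := mem_mk.1 (le_iff.1 hYA a ha)
    exact ⟨b, ⟨A, hA, hb⟩, hab⟩
  · rintro ⟨b, ⟨A, hA, hb⟩, hab⟩
    exact ⟨mk A, ⟨mk A, ⟨A, hA, rfl⟩, le_rfl⟩, mem_mk.2 ⟨b, hb, hab⟩⟩

open Classical in
/-- The image of a class under a function. -/
noncomputable def fmap (h : S → T) (X : Upper S) : Upper T := mk ((rep X).image h)

theorem mem_fmap {h : S → T} (hh : Monotone h) {X : Upper S} {b : T} :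
    Mem b (fmap h X) ↔ ∃ a, Mem a X ∧ h a ≤ b := by
  classical
  simp only [fmap, mem_mk, Finset.mem_image]
  constructor
  · rintro ⟨_, ⟨a, ha, rfl⟩, hb⟩
    exact ⟨a, mem_of_rep ha, hb⟩
  · rintro ⟨a, ha, hb⟩
    obtain ⟨c, hc, hca⟩ := mem_iff.1 ha
    exact ⟨h c, ⟨c, hc, rfl⟩, (hh hca).trans hb⟩

theorem sing_mono : Monotone fun a : S => mk {a} := by
  intro a b h
  exact mem_sing.2 h

theorem join_mono : Monotone (join (S := S)) := by
  intro X Y h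
  refine le_iff.2 fun a ha => ?_
  obtain ⟨Z, hZ, haZ⟩ := mem_join.1 ha
  exact mem_join.2 ⟨Z, le_iff.1 h Z hZ, haZ⟩

end Order

section Prox

variable {S T R : Type u} [PartialOrder S] [Proximity S] [PartialOrder T] [Proximity T]
  [PartialOrder R] [Proximity R]

theorem rel_ideal (r : ApproxRel S T) (Y : Upper T) :
    IsRoundedIdeal (rel (Proximity.prec (S := S))) {X | rel r.rel X Y} := by
  classical
  have hp := (ApproxRel.id S).isMonoRel
  have hr := r.isMonoRel
  refine ⟨⟨?_, ?_, ?_⟩, ?_⟩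
  · intro X X' h hX
    refine (rel_iff hr).2 fun b hb => ?_
    obtain ⟨a, ha, hab⟩ := (rel_iff hr).1 hX b hb
    exact ⟨a, le_iff.1 h a ha, hab⟩
  · obtain ⟨A, hA, -⟩ := exists_finset_choice (P := fun b a => r.rel a b) (rep Y)
      fun b _ => r.inhabited b
    refine ⟨mk A, (rel_iff hr).2 fun b hb => ?_⟩
    obtain ⟨c, hc, hcb⟩ := mem_iff.1 hb
    obtain ⟨a, ha, hac⟩ := hA c hc
    exact ⟨a, mem_mk_of ha, r.up hac hcb⟩
  · intro X hX X' hX'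
    have h : ∀ b ∈ rep Y, ∃ d, r.rel d b ∧ Mem d X ∧ Mem d X' := by
      intro b hb
      obtain ⟨a, ha, hab⟩ := (rel_iff hr).1 hX b (mem_of_rep hb)
      obtain ⟨a', ha', hab'⟩ := (rel_iff hr).1 hX' b (mem_of_rep hb)
      obtain ⟨d, hd, h1, h2⟩ := r.directed hab hab'
      exact ⟨d, hd, ha.up h1, ha'.up h2⟩
    obtain ⟨D, hD, hD'⟩ := exists_finset_choice _ h
    refine ⟨mk D, (rel_iff hr).2 fun b hb => ?_, le_iff.2 fun a ha => ?_, le_iff.2 fun a ha => ?_⟩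
    · obtain ⟨c, hc, hcb⟩ := mem_iff.1 hb
      obtain ⟨d, hd, hdc, -⟩ := hD c hc
      exact ⟨d, mem_mk_of hd, r.up hdc hcb⟩
    · obtain ⟨d, hd, hda⟩ := mem_mk.1 ha
      obtain ⟨_, _, _, h1, _⟩ := hD' d hd
      exact h1.up hda
    · obtain ⟨d, hd, hda⟩ := mem_mk.1 ha
      obtain ⟨_, _, _, _, h1⟩ := hD' d hd
      exact h1.up hda
  · intro X
    constructor
    · intro hX
      have h : ∀ b ∈ rep Y, ∃ a', r.rel a' b ∧ ∃ a, Mem a X ∧ a ≺ a' := by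
        intro b hb
        obtain ⟨a, ha, hab⟩ := (rel_iff hr).1 hX b (mem_of_rep hb)
        obtain ⟨a', h1, h2⟩ := r.left.1 hab
        exact ⟨a', h2, a, ha, h1⟩
      obtain ⟨B, hB, hB'⟩ := exists_finset_choice _ h
      refine ⟨mk B, (rel_iff hp).2 fun b hb => ?_, (rel_iff hr).2 fun b hb => ?_⟩
      · obtain ⟨c, hc, hcb⟩ := mem_mk.1 hb
        obtain ⟨_, _, _, a, ha, hac⟩ := hB' c hc
        exact ⟨a, ha, prec_le hac hcb⟩
      · obtain ⟨c, hc, hcb⟩ := mem_iff.1 hb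
        obtain ⟨a, ha, hac, -⟩ := hB c hc
        exact ⟨a, mem_mk_of ha, r.up hac hcb⟩
    · rintro ⟨X', h, h'⟩
      refine (rel_iff hr).2 fun b hb => ?_
      obtain ⟨a', ha', hab⟩ := (rel_iff hr).1 h' b hb
      obtain ⟨a, ha, haa⟩ := (rel_iff hp).1 h a' ha'
      exact ⟨a, ha, r.left.2 ⟨a', haa, hab⟩⟩

theorem rel_upper (r : ApproxRel S T) (X : Upper S) :
    IsRoundedUpper (rel (Proximity.prec (S := T))) {Y | rel r.rel X Y} := by
  have hp := (ApproxRel.id T).isMonoRel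
  have hr := r.isMonoRel
  refine ⟨?_, ?_⟩
  · intro Y Y' h hY
    exact (rel_iff hr).2 fun b hb => (rel_iff hr).1 hY b (le_iff.1 h b hb)
  · intro Y
    constructor
    · intro hY
      have h : ∀ b ∈ rep Y, ∃ b', b' ≺ b ∧ ∃ a, Mem a X ∧ r.rel a b' := by
        intro b hb
        obtain ⟨a, ha, hab⟩ := (rel_iff hr).1 hY b (mem_of_rep hb)
        obtain ⟨b', h1, h2⟩ := r.right.1 hab
        exact ⟨b', h1, a, ha, h2⟩
      obtain ⟨B, hB, hB'⟩ := exists_finset_choice _ h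
      refine ⟨mk B, (rel_iff hp).2 fun b hb => ?_, (rel_iff hr).2 fun b hb => ?_⟩
      · obtain ⟨c, hc, hcb⟩ := mem_iff.1 hb
        obtain ⟨d, hd, hdc, -⟩ := hB c hc
        exact ⟨d, mem_mk_of hd, prec_le hdc hcb⟩
      · obtain ⟨c, hc, hcb⟩ := mem_mk.1 hb
        obtain ⟨_, _, _, a, ha, hac⟩ := hB' c hc
        exact ⟨a, ha, r.up hac hcb⟩
    · rintro ⟨Y', h, h'⟩
      refine (rel_iff hr).2 fun b hb => ?_
      obtain ⟨b', hb', hbb⟩ := (rel_iff hp).1 h b hb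
      obtain ⟨a, ha, hab⟩ := (rel_iff hr).1 h' b' hb'
      exact ⟨a, ha, r.right.2 ⟨b', hbb, hab⟩⟩

/-- The proximity `≺_U` on the upper powerlocale. -/
instance : Proximity (Upper S) where
  prec := rel Proximity.prec
  prec_ideal := rel_ideal (ApproxRel.id S)
  prec_upper := rel_upper (ApproxRel.id S)

/-- The action of the upper powerlocale on approximable relations: `r ↦ r_U`. -/
def map (r : ApproxRel S T) : ApproxRel (Upper S) (Upper T) where
  rel := rel r.rel
  ideal := rel_ideal r
  upper := rel_upper r

theorem prec_iff {X Y : Upper S} : X ≺ Y ↔ ∀ b, Mem b Y → ∃ a, Mem a X ∧ a ≺ b :=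
  rel_iff (ApproxRel.id S).isMonoRel

theorem map_iff {r : ApproxRel S T} {X : Upper S} {Y : Upper T} :
    (map r).rel X Y ↔ ∀ b, Mem b Y → ∃ a, Mem a X ∧ r.rel a b := rel_iff r.isMonoRel

theorem map_sing_iff {r : ApproxRel S T} {X : Upper S} {b : T} :
    (map r).rel X (mk {b}) ↔ ∃ a, X ≺ mk {a} ∧ r.rel a b := by
  constructor
  · intro h
    obtain ⟨a, ha, hab⟩ := map_iff.1 h b (mem_sing.2 le_rfl)
    obtain ⟨a', h1, h2⟩ := r.left.1 hab
    exact ⟨a', prec_iff.2 fun c hc => ⟨a, ha, prec_le h1 (mem_sing.1 hc)⟩, h2⟩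
  · rintro ⟨a, h, hab⟩
    refine map_iff.2 fun y hy => ?_
    obtain ⟨x, hx, hxa⟩ := prec_iff.1 h a (mem_sing.2 le_rfl)
    exact ⟨x, hx, r.up (r.left.2 ⟨a, hxa, hab⟩) (mem_sing.1 hy)⟩

theorem sing_proxMap : ProxMap fun a : S => mk {a} where
  mono := sing_mono
  prec := by
    intro b b' h
    refine prec_iff.2 fun a ha => ⟨b, mem_sing.2 le_rfl, prec_le h (mem_sing.1 ha)⟩
  cont := by
    intro X b h
    obtain ⟨a, h1, h2⟩ := (map_sing_iff (r := ApproxRel.id S)).1 h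
    exact ⟨a, h2, h1⟩

theorem map_join_iff {r : ApproxRel S T} {X : Upper S} {Y : Upper (Upper T)} :
    (map r).rel X (join Y) ↔ ∃ U, X ≺ join U ∧ (map (map r)).rel U Y := by
  constructor
  · intro h
    have h' : ∀ Z ∈ rep Y, ∃ V, X ≺ V ∧ (map r).rel V Z := by
      intro Z hZ
      refine (map r).left.1 (map_iff.2 fun b hb => ?_)
      exact map_iff.1 h b (mem_join.2 ⟨Z, mem_of_rep hZ, hb⟩)
    obtain ⟨B, hB, hB'⟩ := exists_finset_choice _ h'
    refine ⟨mk B, prec_iff.2 fun b hb => ?_, map_iff.2 fun Z hZ => ?_⟩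
    · obtain ⟨V, hV, hbV⟩ := mem_join.1 hb
      obtain ⟨W, hW, hWV⟩ := mem_mk.1 hV
      obtain ⟨_, _, hXW, _⟩ := hB' W hW
      exact prec_iff.1 hXW b (le_iff.1 hWV b hbV)
    · obtain ⟨Z', hZ', hZZ⟩ := mem_iff.1 hZ
      obtain ⟨V, hV, _, hVZ⟩ := hB Z' hZ'
      exact ⟨V, mem_mk_of hV, (map r).up hVZ hZZ⟩
  · rintro ⟨U, h1, h2⟩
    refine map_iff.2 fun b hb => ?_
    obtain ⟨Z, hZ, hbZ⟩ := mem_join.1 hb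
    obtain ⟨V, hV, hVZ⟩ := map_iff.1 h2 Z hZ
    obtain ⟨a', ha', hab⟩ := map_iff.1 hVZ b hbZ
    obtain ⟨a, ha, haa⟩ := prec_iff.1 h1 a' (mem_join.2 ⟨V, hV, ha'⟩)
    exact ⟨a, ha, r.left.2 ⟨a', haa, hab⟩⟩

theorem join_proxMap : ProxMap (join (S := S)) where
  mono := join_mono
  prec := by
    intro X Y h
    refine prec_iff.2 fun b hb => ?_
    obtain ⟨Z, hZ, hbZ⟩ := mem_join.1 hb
    obtain ⟨W, hW, hWZ⟩ := prec_iff.1 h Z hZ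
    obtain ⟨a, ha, hab⟩ := prec_iff.1 hWZ b hbZ
    exact ⟨a, mem_join.2 ⟨W, hW, ha⟩, hab⟩
  cont := by
    intro X Y h
    obtain ⟨U, h1, h2⟩ := (map_join_iff (r := ApproxRel.id S)).1 h
    exact ⟨U, h2, h1⟩

theorem map_ofMap_iff {h : T → S} (hh : ProxMap h) {X : Upper S} {Y : Upper T} :
    (map (ApproxRel.ofMap h hh)).rel X Y ↔ X ≺ fmap h Y := by
  rw [map_iff, prec_iff]
  constructor
  · intro H a ha
    obtain ⟨b, hb, hba⟩ := (mem_fmap hh.mono).1 ha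
    obtain ⟨c, hc, hcb⟩ := H b hb
    exact ⟨c, hc, prec_le hcb hba⟩
  · intro H b hb
    exact H (h b) ((mem_fmap hh.mono).2 ⟨b, hb, le_rfl⟩)

theorem map_comp (r : ApproxRel S T) (s : ApproxRel T R) :
    map (r.comp s) = (map r).comp (map s) := by
  refine ApproxRel.ext_iff_rel fun X Z => ?_
  rw [ApproxRel.comp_rel]
  constructor
  · intro h
    have h' : ∀ c ∈ rep Z, ∃ b, s.rel b c ∧ ∃ a, Mem a X ∧ r.rel a b := by
      intro c hc
      obtain ⟨a, ha, b, hab, hbc⟩ := map_iff.1 h c (mem_of_rep hc)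
      exact ⟨b, hbc, a, ha, hab⟩
    obtain ⟨B, hB, hB'⟩ := exists_finset_choice _ h'
    refine ⟨mk B, map_iff.2 fun b hb => ?_, map_iff.2 fun c hc => ?_⟩
    · obtain ⟨b', hb', hbb⟩ := mem_mk.1 hb
      obtain ⟨_, _, _, a, ha, hab⟩ := hB' b' hb'
      exact ⟨a, ha, r.up hab hbb⟩
    · obtain ⟨c', hc', hcc⟩ := mem_iff.1 hc
      obtain ⟨b, hb, hbc, -⟩ := hB c' hc'
      exact ⟨b, mem_mk_of hb, s.up hbc hcc⟩
  · rintro ⟨Y, h1, h2⟩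
    refine map_iff.2 fun c hc => ?_
    obtain ⟨b, hb, hbc⟩ := map_iff.1 h2 c hc
    obtain ⟨a, ha, hab⟩ := map_iff.1 h1 b hb
    exact ⟨a, ha, b, hab, hbc⟩

/-- The counit: `X ε a` iff `X ≺_U {a}`. -/
def counit (S : Type u) [PartialOrder S] [Proximity S] : ApproxRel (Upper S) S :=
  ApproxRel.ofMap (fun a => mk {a}) sing_proxMap

/-- The comultiplication: `X ν 𝒰` iff `X ≺_U ⋃ 𝒰`. -/
noncomputable def comult (S : Type u) [PartialOrder S] [Proximity S] :
    ApproxRel (Upper S) (Upper (Upper S)) :=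
  ApproxRel.ofMap join join_proxMap

theorem comp_map_ofMap_rel {r : ApproxRel R (Upper S)} {h : T → S} {hh : ProxMap h} {a : R}
    {b : Upper T} : (r.comp (map (ApproxRel.ofMap h hh))).rel a b ↔ r.rel a (fmap h b) := by
  rw [ApproxRel.comp_rel, ApproxRel.right]
  constructor
  · rintro ⟨c, h1, h2⟩
    exact ⟨c, (map_ofMap_iff hh).1 h2, h1⟩
  · rintro ⟨c, h1, h2⟩
    exact ⟨c, h2, (map_ofMap_iff hh).2 h1⟩

theorem counit_natural (r : ApproxRel S T) :
    (map r).comp (counit T) = (counit S).comp r :=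
  ApproxRel.ext_iff_rel fun _ _ => ApproxRel.comp_ofMap_rel.trans map_sing_iff

theorem comult_natural (r : ApproxRel S T) :
    (map r).comp (comult T) = (comult S).comp (map (map r)) :=
  ApproxRel.ext_iff_rel fun _ _ => ApproxRel.comp_ofMap_rel.trans map_join_iff

theorem coassoc :
    (comult S).comp (map (comult S)) = (comult S).comp (comult (Upper S)) := by
  refine ApproxRel.ext_iff_rel fun X Y => ?_
  refine comp_map_ofMap_rel.trans (Iff.trans ?_ ApproxRel.comp_ofMap_rel.symm)
  refine iff_of_eq (congrArg (fun Z => X ≺ Z) (ext_mem fun a => ?_))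
  simp only [mem_join, mem_fmap join_mono]
  constructor
  · rintro ⟨Z, ⟨W, hW, hZ⟩, ha⟩
    obtain ⟨V, hV, haV⟩ := mem_join.1 (le_iff.1 hZ a ha)
    exact ⟨V, ⟨W, hW, hV⟩, haV⟩
  · rintro ⟨V, ⟨W, hW, hV⟩, haV⟩
    exact ⟨join W, ⟨W, hW, le_rfl⟩, mem_join.2 ⟨V, hV, haV⟩⟩

theorem comult_counit : (comult S).comp (counit (Upper S)) = ApproxRel.id (Upper S) := by
  refine ApproxRel.ext_iff_rel fun X Y => ApproxRel.comp_ofMap_rel.trans ?_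
  refine iff_of_eq (congrArg (fun Z => X ≺ Z) (ext_mem fun a => ?_))
  simp only [mem_join, mem_sing]
  exact ⟨fun ⟨Z, hZ, ha⟩ => le_iff.1 hZ a ha, fun ha => ⟨Y, le_rfl, ha⟩⟩

theorem comult_map_counit : (comult S).comp (map (counit S)) = ApproxRel.id (Upper S) := by
  refine ApproxRel.ext_iff_rel fun X Y => comp_map_ofMap_rel.trans ?_
  refine iff_of_eq (congrArg (fun Z => X ≺ Z) (ext_mem fun a => ?_))
  simp only [mem_join, mem_fmap sing_mono]
  constructor
  · rintro ⟨Z, ⟨b, hb, hZ⟩, ha⟩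
    exact hb.up (mem_sing.1 (le_iff.1 hZ a ha))
  · intro ha
    exact ⟨_, ⟨a, ha, le_rfl⟩, mem_sing.2 le_rfl⟩

end Prox

end Upper

/-! ### The comonads of the lower and the upper powerlocale -/

/-- The comonad `P_L` of the lower powerlocale. -/
noncomputable def lowerComonad : Comonad PxPos.{u} where
  obj S := ⟨Lower S.carrier⟩
  map r := Lower.map r
  map_id _ := rfl
  map_comp r s := Lower.map_comp r s
  ε :=
    { app := fun S => Lower.counit S.carrier
      naturality := fun _ _ r => Lower.counit_natural r }
  δ :=
    { app := fun S => Lower.comult S.carrier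
      naturality := fun _ _ r => Lower.comult_natural r }
  coassoc S := Lower.coassoc (S := S.carrier)
  left_counit S := Lower.comult_counit (S := S.carrier)
  right_counit S := Lower.comult_map_counit (S := S.carrier)

/-- The comonad `P_U` of the upper powerlocale. -/
noncomputable def upperComonad : Comonad PxPos.{u} where
  obj S := ⟨Upper S.carrier⟩
  map r := Upper.map r
  map_id _ := rfl
  map_comp r s := Upper.map_comp r s
  ε :=
    { app := fun S => Upper.counit S.carrier
      naturality := fun _ _ r => Upper.counit_natural r }
  δ :=
    { app := fun S => Upper.comult S.carrier
      naturality := fun _ _ r => Upper.comult_natural r }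
  coassoc S := Upper.coassoc (S := S.carrier)
  left_counit S := Upper.comult_counit (S := S.carrier)
  right_counit S := Upper.comult_map_counit (S := S.carrier)

/-! ### Distributive laws of comonads -/

/-- A distributive law of the comonad `K` over the comonad `T`: a natural transformation
`T ∘ K ⟶ K ∘ T` compatible with counits and comultiplications. -/
structure DistributiveLaw {C : Type u} [Category.{v} C] (K T : Comonad C) where
  law : K.toFunctor ⋙ T.toFunctor ⟶ T.toFunctor ⋙ K.toFunctor
  counit_left : ∀ X, law.app X ≫ K.map (T.ε.app X) = T.ε.app (K.obj X)
  counit_right : ∀ X, law.app X ≫ K.ε.app (T.obj X) = T.map (K.ε.app X)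
  comult_left : ∀ X, law.app X ≫ K.δ.app (T.obj X) =
    T.map (K.δ.app X) ≫ law.app (K.obj X) ≫ K.map (law.app X)
  comult_right : ∀ X, law.app X ≫ K.map (T.δ.app X) =
    T.δ.app (K.obj X) ≫ T.map (law.app X) ≫ law.app (T.obj X)

section Composite

variable {C : Type u} [Category.{v} C] (K T : C ⥤ C) (eK : ∀ X, K.obj X ⟶ X)
  (dK : ∀ X, K.obj X ⟶ K.obj (K.obj X)) (eT : ∀ X, T.obj X ⟶ X)
  (dT : ∀ X, T.obj X ⟶ T.obj (T.obj X)) (s : ∀ X, T.obj (K.obj X) ⟶ K.obj (T.obj X))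

theorem composite_counit_nat
    (eKn : ∀ ⦃X Y⦄ (f : X ⟶ Y), K.map f ≫ eK Y = eK X ≫ f)
    (eTn : ∀ ⦃X Y⦄ (f : X ⟶ Y), T.map f ≫ eT Y = eT X ≫ f) ⦃X Y : C⦄ (f : X ⟶ Y) :
    T.map (K.map f) ≫ T.map (eK Y) ≫ eT Y = (T.map (eK X) ≫ eT X) ≫ f := by
  rw [← T.map_comp_assoc, eKn, T.map_comp_assoc, eTn, Category.assoc]

theorem composite_comult_nat
    (dKn : ∀ ⦃X Y⦄ (f : X ⟶ Y), K.map f ≫ dK Y = dK X ≫ K.map (K.map f))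
    (dTn : ∀ ⦃X Y⦄ (f : X ⟶ Y), T.map f ≫ dT Y = dT X ≫ T.map (T.map f))
    (sn : ∀ ⦃X Y⦄ (f : X ⟶ Y), T.map (K.map f) ≫ s Y = s X ≫ K.map (T.map f))
    ⦃X Y : C⦄ (f : X ⟶ Y) :
    T.map (K.map f) ≫ T.map (dK Y) ≫ dT (K.obj (K.obj Y)) ≫ T.map (s (K.obj Y)) =
      (T.map (dK X) ≫ dT (K.obj (K.obj X)) ≫ T.map (s (K.obj X))) ≫
        T.map (K.map (T.map (K.map f))) := by
  rw [← T.map_comp_assoc, dKn, T.map_comp_assoc, ← Category.assoc (T.map (K.map (K.map f))), dTn]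
  simp only [Category.assoc, ← T.map_comp, sn]

theorem composite_coassoc
    (dTn : ∀ ⦃X Y⦄ (f : X ⟶ Y), T.map f ≫ dT Y = dT X ≫ T.map (T.map f))
    (sn : ∀ ⦃X Y⦄ (f : X ⟶ Y), T.map (K.map f) ≫ s Y = s X ≫ K.map (T.map f))
    (aK : ∀ X, dK X ≫ K.map (dK X) = dK X ≫ dK (K.obj X))
    (aT : ∀ X, dT X ≫ T.map (dT X) = dT X ≫ dT (T.obj X))
    (sl : ∀ X, s X ≫ dK (T.obj X) = T.map (dK X) ≫ s (K.obj X) ≫ K.map (s X))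
    (sr : ∀ X, s X ≫ K.map (dT X) = dT (K.obj X) ≫ T.map (s X) ≫ s (T.obj X)) (X : C) :
    (T.map (dK X) ≫ dT (K.obj (K.obj X)) ≫ T.map (s (K.obj X))) ≫
        T.map (K.map (T.map (dK X) ≫ dT (K.obj (K.obj X)) ≫ T.map (s (K.obj X)))) =
      (T.map (dK X) ≫ dT (K.obj (K.obj X)) ≫ T.map (s (K.obj X))) ≫
        T.map (dK (T.obj (K.obj X))) ≫ dT (K.obj (K.obj (T.obj (K.obj X)))) ≫
          T.map (s (K.obj (T.obj (K.obj X)))) := by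
  have e1 : s (K.obj X) ≫ K.map (T.map (dK X) ≫ dT (K.obj (K.obj X)) ≫ T.map (s (K.obj X))) =
      T.map (K.map (dK X)) ≫ dT (K.obj (K.obj (K.obj X))) ≫ T.map (s (K.obj (K.obj X))) ≫
        s (T.obj (K.obj (K.obj X))) ≫ K.map (T.map (s (K.obj X))) := by
    rw [K.map_comp, K.map_comp, ← Category.assoc, ← sn, Category.assoc,
      ← Category.assoc (s (K.obj (K.obj X))), sr]
    simp only [Category.assoc]
  have e2 : T.map (s (K.obj X)) ≫ T.map (dK (T.obj (K.obj X))) ≫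
        dT (K.obj (K.obj (T.obj (K.obj X)))) ≫ T.map (s (K.obj (T.obj (K.obj X)))) =
      T.map (T.map (dK (K.obj X))) ≫ dT (T.obj (K.obj (K.obj (K.obj X)))) ≫
        T.map (T.map (s (K.obj (K.obj X))) ≫ s (T.obj (K.obj (K.obj X))) ≫
          K.map (T.map (s (K.obj X)))) := by
    rw [← T.map_comp_assoc, sl, T.map_comp_assoc,
      ← Category.assoc (T.map (s (K.obj (K.obj X)) ≫ K.map (s (K.obj X)))), dTn]
    simp only [Category.assoc, ← T.map_comp]
    rw [T.map_comp (s (K.obj (K.obj X))), Category.assoc, sn]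
  have e3 : T.map (dK X) ≫ dT (K.obj (K.obj X)) ≫ T.map (T.map (K.map (dK X))) ≫
        T.map (dT (K.obj (K.obj (K.obj X)))) =
      T.map (dK X) ≫ dT (K.obj (K.obj X)) ≫ T.map (T.map (dK (K.obj X))) ≫
        dT (T.obj (K.obj (K.obj (K.obj X)))) := by
    rw [← Category.assoc (dT (K.obj (K.obj X))), ← dTn, Category.assoc, aT,
      ← T.map_comp_assoc, aK, ← Category.assoc (dT (K.obj (K.obj X))), ← dTn, Category.assoc,
      T.map_comp_assoc]
  simp only [Category.assoc]
  rw [← T.map_comp, e1, e2, T.map_comp, T.map_comp]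
  have e4 := congrArg (fun z => z ≫ T.map (T.map (s (K.obj (K.obj X))) ≫
    s (T.obj (K.obj (K.obj X))) ≫ K.map (T.map (s (K.obj X))))) e3
  simpa only [Category.assoc] using e4

theorem composite_left_counit
    (dTn : ∀ ⦃X Y⦄ (f : X ⟶ Y), T.map f ≫ dT Y = dT X ≫ T.map (T.map f))
    (cK : ∀ X, dK X ≫ eK (K.obj X) = 𝟙 _) (cT : ∀ X, dT X ≫ eT (T.obj X) = 𝟙 _)
    (sr : ∀ X, s X ≫ eK (T.obj X) = T.map (eK X)) (X : C) :
    (T.map (dK X) ≫ dT (K.obj (K.obj X)) ≫ T.map (s (K.obj X))) ≫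
      T.map (eK (T.obj (K.obj X))) ≫ eT (T.obj (K.obj X)) = 𝟙 (T.obj (K.obj X)) := by
  simp only [Category.assoc]
  rw [← T.map_comp_assoc (s (K.obj X)), sr, ← Category.assoc (dT (K.obj (K.obj X))), ← dTn,
    Category.assoc, cT, Category.comp_id, ← T.map_comp, cK, T.map_id]

theorem composite_right_counit
    (dTn : ∀ ⦃X Y⦄ (f : X ⟶ Y), T.map f ≫ dT Y = dT X ≫ T.map (T.map f))
    (sn : ∀ ⦃X Y⦄ (f : X ⟶ Y), T.map (K.map f) ≫ s Y = s X ≫ K.map (T.map f))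
    (cK : ∀ X, dK X ≫ K.map (eK X) = 𝟙 _) (cT : ∀ X, dT X ≫ T.map (eT X) = 𝟙 _)
    (sl : ∀ X, s X ≫ K.map (eT X) = eT (K.obj X)) (X : C) :
    (T.map (dK X) ≫ dT (K.obj (K.obj X)) ≫ T.map (s (K.obj X))) ≫
      T.map (K.map (T.map (eK X) ≫ eT X)) = 𝟙 (T.obj (K.obj X)) := by
  have h4 : s (K.obj X) ≫ K.map (T.map (eK X) ≫ eT X) = T.map (K.map (eK X)) ≫ eT (K.obj X) := by
    rw [K.map_comp, ← Category.assoc, ← sn, Category.assoc, sl]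
  simp only [Category.assoc]
  rw [← T.map_comp, h4, T.map_comp, ← Category.assoc (dT (K.obj (K.obj X))), ← dTn,
    Category.assoc, cT, Category.comp_id, ← T.map_comp, cK, T.map_id]

/-- The composite comonad `T ∘ K` determined by a distributive law of `K` over `T`. -/
def DistributiveLaw.composite {K T : Comonad C} (d : DistributiveLaw K T) : Comonad C where
  toFunctor := K.toFunctor ⋙ T.toFunctor
  ε :=
    { app := fun X => T.map (K.ε.app X) ≫ T.ε.app X
      naturality := fun _ _ f => composite_counit_nat K.toFunctor T.toFunctor K.ε.app T.ε.app
        (fun _ _ f => K.ε.naturality f) (fun _ _ f => T.ε.naturality f) f }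
  δ :=
    { app := fun X => T.map (K.δ.app X) ≫ T.δ.app (K.obj (K.obj X)) ≫
        T.map (d.law.app (K.obj X))
      naturality := fun _ _ f => composite_comult_nat K.toFunctor T.toFunctor K.δ.app T.δ.app
        d.law.app (fun _ _ f => K.δ.naturality f) (fun _ _ f => T.δ.naturality f)
        (fun _ _ f => d.law.naturality f) f }
  coassoc X := composite_coassoc K.toFunctor T.toFunctor K.δ.app T.δ.app d.law.app
    (fun _ _ f => T.δ.naturality f) (fun _ _ f => d.law.naturality f) K.coassoc T.coassoc
    d.comult_left d.comult_right X
  left_counit X := composite_left_counit K.toFunctor T.toFunctor K.ε.app K.δ.app T.ε.app T.δ.app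
    d.law.app (fun _ _ f => T.δ.naturality f) K.left_counit T.left_counit d.counit_right X
  right_counit X := composite_right_counit K.toFunctor T.toFunctor K.ε.app K.δ.app T.ε.app
    T.δ.app d.law.app (fun _ _ f => T.δ.naturality f) (fun _ _ f => d.law.naturality f)
    K.right_counit T.right_counit d.counit_left X

end Composite

/-! ### The double powerlocale -/

namespace Double

section Order

variable {S T : Type u} [PartialOrder S] [PartialOrder T]

open Classical in
/-- The operation `𝒱 ↦ 𝒱*` on classes. It does not depend on representatives: see `starMap_mk`. -/
noncomputable def starMap (V : Lower (Upper S)) : Upper (Lower S) :=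
  Upper.mk ((star ((Lower.rep V).image Upper.rep)).image Lower.mk)

theorem mem_starMap_aux {V : Finset (Finset S)} {X : Lower S} :
    (∃ B ∈ star V, Lower.mk B ≤ X) ↔ ∀ A ∈ V, ∃ a ∈ A, Lower.Mem a X := by
  classical
  constructor
  · rintro ⟨B, hB, hX⟩ A hA
    obtain ⟨a, ha, hb⟩ := (mem_star.1 hB).2 A hA
    exact ⟨a, ha, Lower.le_iff.1 hX a (Lower.mem_mk_of hb)⟩
  · intro h
    obtain ⟨B, hB, hB'⟩ := exists_finset_choice (P := fun A a => a ∈ A ∧ Lower.Mem a X) V h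
    obtain ⟨D, hD, hDB⟩ := exists_star_subset (U := V) (B := B) fun A hA => by
      obtain ⟨a, ha, haA, -⟩ := hB A hA
      exact ⟨a, haA, ha⟩
    refine ⟨D, hD, Lower.le_iff.2 fun a ha => ?_⟩
    obtain ⟨b, hb, hab⟩ := Lower.mem_mk.1 ha
    obtain ⟨_, _, _, hbX⟩ := hB' b (hDB hb)
    exact hbX.down hab

theorem mem_starMap {V : Lower (Upper S)} {X : Lower S} :
    Upper.Mem X (starMap V) ↔ ∀ W, Lower.Mem W V → ∃ a, Lower.Mem a X ∧ Upper.Mem a W := by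
  classical
  have h : Upper.Mem X (starMap V) ↔ ∃ B ∈ star ((Lower.rep V).image Upper.rep),
      Lower.mk B ≤ X := by
    simp [starMap, Upper.mem_mk]
  rw [h, mem_starMap_aux]
  constructor
  · intro H W hW
    obtain ⟨W', hW', hle⟩ := Lower.mem_iff.1 hW
    obtain ⟨a, ha, haX⟩ := H _ (Finset.mem_image_of_mem _ hW')
    exact ⟨a, haX, Upper.le_iff.1 hle a (Upper.mem_of_rep ha)⟩
  · intro H A hA
    obtain ⟨W, hW, rfl⟩ := Finset.mem_image.1 hA
    obtain ⟨a, haX, haW⟩ := H W (Lower.mem_of_rep hW)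
    obtain ⟨b, hb, hba⟩ := Upper.mem_iff.1 haW
    exact ⟨b, hb, haX.down hba⟩

open Classical in
theorem starMap_mk (V : Finset (Finset S)) :
    starMap (Lower.mk (V.image Upper.mk)) = Upper.mk ((star V).image Lower.mk) := by
  refine Upper.ext_mem fun X => ?_
  have h : Upper.Mem X (Upper.mk ((star V).image Lower.mk)) ↔ ∃ B ∈ star V, Lower.mk B ≤ X := by
    simp [Upper.mem_mk]
  rw [h, mem_starMap_aux, mem_starMap]
  constructor
  · intro H A hA
    obtain ⟨a, haX, haA⟩ := H (Upper.mk A) (Lower.mem_mk_of (Finset.mem_image_of_mem _ hA))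
    obtain ⟨b, hb, hba⟩ := Upper.mem_mk.1 haA
    exact ⟨b, hb, haX.down hba⟩
  · intro H W hW
    obtain ⟨_, hW', hle⟩ := Lower.mem_mk.1 hW
    obtain ⟨A, hA, rfl⟩ := Finset.mem_image.1 hW'
    obtain ⟨a, ha, haX⟩ := H A hA
    exact ⟨a, haX, Upper.le_iff.1 hle a (Upper.mem_mk_of ha)⟩

theorem starMap_mono : Monotone (starMap (S := S)) := by
  intro V V' h
  refine Upper.le_iff.2 fun X hX => mem_starMap.2 fun W hW => ?_
  exact mem_starMap.1 hX W (Lower.le_iff.1 h W hW)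

theorem starMap_surj (U : Upper (Lower S)) : ∃ V : Lower (Upper S), starMap V = U := by
  classical
  let F : Finset (Finset S) := (Upper.rep U).image Lower.rep
  refine ⟨Lower.mk ((star F).image Upper.mk), Upper.ext_mem fun X => ?_⟩
  rw [mem_starMap]
  constructor
  · intro H
    by_contra hX
    have h : ∀ Y ∈ Upper.rep U, ∃ a, a ∈ Lower.rep Y ∧ ¬ Lower.Mem a X := by
      intro Y hY
      by_contra h
      push Not at h
      refine hX (Upper.mem_iff.2 ⟨Y, hY, Lower.le_iff.2 fun a ha => ?_⟩)
      obtain ⟨b, hb, hab⟩ := Lower.mem_iff.1 ha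
      exact (h b hb).down hab
    obtain ⟨B, hB, hB'⟩ := exists_finset_choice _ h
    obtain ⟨D, hD, hDB⟩ := exists_star_subset (U := F) (B := B) fun A hA => by
      obtain ⟨Y, hY, rfl⟩ := Finset.mem_image.1 hA
      obtain ⟨a, ha, haY, -⟩ := hB Y hY
      exact ⟨a, haY, ha⟩
    obtain ⟨a, haX, haD⟩ := H (Upper.mk D) (Lower.mem_mk_of (Finset.mem_image_of_mem _ hD))
    obtain ⟨b, hb, hba⟩ := Upper.mem_mk.1 haD
    obtain ⟨_, _, _, hbX⟩ := hB' b (hDB hb)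
    exact hbX (haX.down hba)
  · intro hX W hW
    obtain ⟨Y, hY, hYX⟩ := Upper.mem_iff.1 hX
    obtain ⟨_, hW', hle⟩ := Lower.mem_mk.1 hW
    obtain ⟨D, hD, rfl⟩ := Finset.mem_image.1 hW'
    obtain ⟨a, ha, haD⟩ := (mem_star.1 hD).2 _ (Finset.mem_image_of_mem _ hY)
    exact ⟨a, Lower.le_iff.1 hYX a (Lower.mem_of_rep ha),
      Upper.le_iff.1 hle a (Upper.mem_mk_of haD)⟩

end Order

section Prox

variable {S T : Type u} [PartialOrder S] [Proximity S] [PartialOrder T] [Proximity T]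

/-- `𝒱 (r_U)_L 𝒴` if and only if `𝒱* (r_L)_U 𝒴*`. -/
theorem map_starMap_iff {r : ApproxRel S T} {V : Lower (Upper S)} {Y : Lower (Upper T)} :
    (Upper.map (Lower.map r)).rel (starMap V) (starMap Y) ↔
      (Lower.map (Upper.map r)).rel V Y := by
  classical
  rw [Upper.map_iff, Lower.map_iff]
  constructor
  · intro H Z hZ
    by_contra hcon
    have h : ∀ W ∈ Lower.rep Y, ∃ b, Upper.Mem b W ∧ ∀ a, Upper.Mem a Z → ¬ r.rel a b := by
      intro W hW
      by_contra h
      push Not at h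
      exact hcon ⟨W, Lower.mem_of_rep hW, Upper.map_iff.2 h⟩
    obtain ⟨B, hB, hB'⟩ := exists_finset_choice _ h
    obtain ⟨X, hX, hXB⟩ := H (Lower.mk B) (mem_starMap.2 fun W hW => by
      obtain ⟨W', hW', hle⟩ := Lower.mem_iff.1 hW
      obtain ⟨b, hb, hbW, -⟩ := hB W' hW'
      exact ⟨b, Lower.mem_mk_of hb, Upper.le_iff.1 hle b hbW⟩)
    obtain ⟨a, haX, haZ⟩ := mem_starMap.1 hX Z hZ
    obtain ⟨b, hb, hab⟩ := Lower.map_iff.1 hXB a haX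
    obtain ⟨b', hb', hbb⟩ := Lower.mem_mk.1 hb
    obtain ⟨_, _, _, h1⟩ := hB' b' hb'
    exact h1 a haZ (r.up hab hbb)
  · intro H X hX
    have h : ∀ Z ∈ Lower.rep V, ∃ a, Upper.Mem a Z ∧ ∃ b, Lower.Mem b X ∧ r.rel a b := by
      intro Z hZ
      obtain ⟨W, hW, hZW⟩ := H Z (Lower.mem_of_rep hZ)
      obtain ⟨b, hbX, hbW⟩ := mem_starMap.1 hX W hW
      obtain ⟨a, ha, hab⟩ := Upper.map_iff.1 hZW b hbW
      exact ⟨a, ha, b, hbX, hab⟩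
    obtain ⟨A, hA, hA'⟩ := exists_finset_choice _ h
    refine ⟨Lower.mk A, mem_starMap.2 fun Z hZ => ?_, Lower.map_iff.2 fun a ha => ?_⟩
    · obtain ⟨Z', hZ', hle⟩ := Lower.mem_iff.1 hZ
      obtain ⟨a, ha, haZ, -⟩ := hA Z' hZ'
      exact ⟨a, Lower.mem_mk_of ha, Upper.le_iff.1 hle a haZ⟩
    · obtain ⟨a', ha', haa⟩ := Lower.mem_mk.1 ha
      obtain ⟨_, _, _, b, hb, hab⟩ := hA' a' ha'
      exact ⟨b, hb, r.down haa hab⟩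

theorem prec_starMap_iff {V W : Lower (Upper S)} : starMap V ≺ starMap W ↔ V ≺ W :=
  map_starMap_iff (r := ApproxRel.id S)

theorem starMap_proxMap : ProxMap (starMap (S := S)) where
  mono := starMap_mono
  prec := fun h => prec_starMap_iff.2 h
  cont := by
    intro U V h
    obtain ⟨U', h1, h2⟩ := prec_interp h
    obtain ⟨V', rfl⟩ := starMap_surj U'
    exact ⟨V', prec_starMap_iff.1 h2, h1⟩

/-- The relation `σ` from `P_U P_L S` to `P_L P_U S`: `𝒰 σ 𝒱` iff `𝒰 (≺_L)_U 𝒱*`. -/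
noncomputable def sigma (S : Type u) [PartialOrder S] [Proximity S] :
    ApproxRel (Upper (Lower S)) (Lower (Upper S)) :=
  ApproxRel.ofMap starMap starMap_proxMap

theorem sigma_natural (r : ApproxRel S T) :
    (Upper.map (Lower.map r)).comp (sigma T) = (sigma S).comp (Lower.map (Upper.map r)) := by
  refine ApproxRel.ext_iff_rel fun U Y => ApproxRel.comp_ofMap_rel.trans ?_
  rw [ApproxRel.comp_rel]
  constructor
  · intro h
    obtain ⟨U', h1, h2⟩ := ApproxRel.left _ |>.1 h
    obtain ⟨V, rfl⟩ := starMap_surj U'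
    exact ⟨V, h1, map_starMap_iff.1 h2⟩
  · rintro ⟨V, h1, h2⟩
    exact ApproxRel.left _ |>.2 ⟨starMap V, h1, map_starMap_iff.2 h2⟩

theorem sigma_counit_left :
    (sigma S).comp (Lower.map (Upper.counit S)) = Upper.counit (Lower S) := by
  refine ApproxRel.ext_iff_rel fun U Y => Lower.comp_map_ofMap_rel.trans ?_
  refine iff_of_eq (congrArg (fun Z => U ≺ Z) (Upper.ext_mem fun X => ?_))
  rw [mem_starMap, Upper.mem_sing]
  simp only [Lower.mem_fmap Upper.sing_mono]
  constructor
  · intro H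
    refine Lower.le_iff.2 fun a ha => ?_
    obtain ⟨b, hb, hab⟩ := H _ ⟨a, ha, le_rfl⟩
    exact hb.down (Upper.mem_sing.1 hab)
  · rintro H W ⟨a, ha, hW⟩
    exact ⟨a, Lower.le_iff.1 H a ha, hW⟩

theorem sigma_counit_right :
    (sigma S).comp (Lower.counit (Upper S)) = Upper.map (Lower.counit S) := by
  refine ApproxRel.ext_iff_rel fun U Y => ApproxRel.comp_ofMap_rel.trans
    (Iff.trans ?_ (Upper.map_ofMap_iff Lower.sing_proxMap).symm)
  refine iff_of_eq (congrArg (fun Z => U ≺ Z) (Upper.ext_mem fun X => ?_))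
  rw [mem_starMap, Upper.mem_fmap Lower.sing_mono]
  simp only [Lower.mem_sing]
  constructor
  · intro H
    obtain ⟨a, haX, haY⟩ := H Y le_rfl
    exact ⟨a, haY, haX⟩
  · rintro ⟨a, haY, haX⟩ W hW
    exact ⟨a, haX, Upper.le_iff.1 hW a haY⟩

theorem sigma_comult_left :
    (sigma S).comp (Lower.comult (Upper S)) =
      (Upper.map (Lower.comult S)).comp ((sigma (Lower S)).comp (Lower.map (sigma S))) := by
  refine ApproxRel.ext_iff_rel fun U W => ApproxRel.comp_ofMap_rel.trans ?_
  have h : ∀ Z, (Upper.map (Lower.comult S)).rel U Z ↔ U ≺ Upper.fmap Lower.join Z :=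
    fun Z => Upper.map_ofMap_iff Lower.join_proxMap
  have h' : ((Upper.map (Lower.comult S)).comp ((sigma (Lower S)).comp
      (Lower.map (sigma S)))).rel U W ↔
      (Upper.map (Lower.comult S)).rel U (starMap (Lower.fmap starMap W)) := by
    constructor
    · rintro ⟨Z, h1, h2⟩
      exact ApproxRel.right _ |>.2 ⟨Z, Lower.comp_map_ofMap_rel.1 h2, h1⟩
    · intro h1
      obtain ⟨Z, h2, h3⟩ := ApproxRel.right _ |>.1 h1
      exact ⟨Z, h3, Lower.comp_map_ofMap_rel.2 h2⟩
  rw [h', h]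
  refine iff_of_eq (congrArg (fun Z => U ≺ Z) (Upper.ext_mem fun X => ?_))
  rw [mem_starMap, Upper.mem_fmap Lower.join_mono]
  simp only [mem_starMap, Lower.mem_join, Lower.mem_fmap starMap_mono]
  constructor
  · intro H
    refine ⟨Lower.mk {X}, ?_, ?_⟩
    · rintro A ⟨V, hV, hA⟩
      refine ⟨X, Lower.mem_sing.2 le_rfl, Upper.le_iff.1 hA X (mem_starMap.2 fun Z hZ => ?_)⟩
      exact H Z ⟨V, hV, hZ⟩
    · refine Lower.le_iff.2 fun a ha => ?_
      obtain ⟨Y, hY, haY⟩ := Lower.mem_join.1 ha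
      exact Lower.le_iff.1 (Lower.mem_sing.1 hY) a haY
  · rintro ⟨Z, hZ, hle⟩ A ⟨V, hV, hA⟩
    obtain ⟨Y, hY, hYV⟩ := hZ (starMap V) ⟨V, hV, le_rfl⟩
    obtain ⟨a, haY, haA⟩ := mem_starMap.1 hYV A hA
    exact ⟨a, Lower.le_iff.1 hle a (Lower.mem_join.2 ⟨Y, hY, haY⟩), haA⟩

theorem sigma_comult_right :
    (sigma S).comp (Lower.map (Upper.comult S)) =
      (Upper.comult (Lower S)).comp ((Upper.map (sigma S)).comp (sigma (Upper S))) := by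
  refine ApproxRel.ext_iff_rel fun U W => Lower.comp_map_ofMap_rel.trans ?_
  have h' : ((Upper.comult (Lower S)).comp ((Upper.map (sigma S)).comp
      (sigma (Upper S)))).rel U W ↔
      (Upper.comult (Lower S)).rel U (Upper.fmap starMap (starMap W)) := by
    constructor
    · rintro ⟨Z, h1, h2⟩
      exact ApproxRel.right _ |>.2
        ⟨Z, (Upper.map_ofMap_iff starMap_proxMap).1 (ApproxRel.comp_ofMap_rel.1 h2), h1⟩
    · intro h1
      obtain ⟨Z, h2, h3⟩ := ApproxRel.right _ |>.1 h1
      exact ⟨Z, h3, ApproxRel.comp_ofMap_rel.2 ((Upper.map_ofMap_iff starMap_proxMap).2 h2)⟩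
  rw [h']
  refine iff_of_eq (congrArg (fun Z => U ≺ Z) (Upper.ext_mem fun X => ?_))
  rw [mem_starMap, Upper.mem_join]
  simp only [Lower.mem_fmap Upper.join_mono, Upper.mem_fmap starMap_mono]
  constructor
  · intro H
    have h : ∀ A ∈ Lower.rep W, ∃ V, Upper.Mem V A ∧ ∃ a, Lower.Mem a X ∧ Upper.Mem a V := by
      intro A hA
      obtain ⟨a, haX, haA⟩ := H _ ⟨A, Lower.mem_of_rep hA, le_rfl⟩
      obtain ⟨V, hV, haV⟩ := Upper.mem_join.1 haA
      exact ⟨V, hV, a, haX, haV⟩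
    obtain ⟨B, hB, hB'⟩ := exists_finset_choice _ h
    refine ⟨starMap (Lower.mk B), ⟨Lower.mk B, mem_starMap.2 fun A hA => ?_, le_rfl⟩,
      mem_starMap.2 fun V hV => ?_⟩
    · obtain ⟨A', hA', hle⟩ := Lower.mem_iff.1 hA
      obtain ⟨V, hV, hVA, -⟩ := hB A' hA'
      exact ⟨V, Lower.mem_mk_of hV, Upper.le_iff.1 hle V hVA⟩
    · obtain ⟨V', hV', hle⟩ := Lower.mem_mk.1 hV
      obtain ⟨_, _, _, a, haX, haV⟩ := hB' V' hV'
      exact ⟨a, haX, Upper.le_iff.1 hle a haV⟩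
  · rintro ⟨Y, ⟨Z, hZ, hle⟩, hXY⟩ A ⟨A', hA', hA⟩
    obtain ⟨V, hVZ, hVA⟩ := mem_starMap.1 hZ A' hA'
    obtain ⟨a, haX, haV⟩ := mem_starMap.1 (Upper.le_iff.1 hle X hXY) V hVZ
    exact ⟨a, haX, Upper.le_iff.1 hA a (Upper.mem_join.2 ⟨V, hVA, haV⟩)⟩

end Prox

end Double

/-- The distributive law `σ` of `P_L` over `P_U`. -/
noncomputable def sigmaLaw : DistributiveLaw lowerComonad.{u} upperComonad.{u} where
  law :=
    { app := fun S => Double.sigma S.carrier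
      naturality := fun _ _ r => Double.sigma_natural r }
  counit_left S := Double.sigma_counit_left (S := S.carrier)
  counit_right S := Double.sigma_counit_right (S := S.carrier)
  comult_left S := Double.sigma_comult_left (S := S.carrier)
  comult_right S := Double.sigma_comult_right (S := S.carrier)

/-- The double powerlocale: the composite comonad `P_U ∘ P_L`. -/
noncomputable def doublePowerlocale : Comonad PxPos.{u} := sigmaLaw.composite

/-! ### Localized strong proximity join-semilattices -/

section Localized

/-- A proximity join-semilattice (a join-semilattice with zero and a proximity) is strong. -/
class IsStrong (S : Type u) [SemilatticeSup S] [OrderBot S] [Proximity S] : Prop where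
  bot : ∀ a : S, a ≺ ⊥ → a = ⊥
  sup : ∀ a b c : S, a ≺ b ⊔ c → ∃ b' c', a ≤ b' ⊔ c' ∧ b' ≺ b ∧ c' ≺ c

/-- A strong proximity join-semilattice is localized. -/
class IsLocalized (S : Type u) [SemilatticeSup S] [OrderBot S] [Proximity S] : Prop where
  localized : ∀ a b c d : S, a ≺ b → b ≤ c ⊔ d →
    ∃ a₁ a₂, (a₁ ≺ b ∧ a₁ ≺ c) ∧ (a₂ ≺ b ∧ a₂ ≺ d) ∧ a ≺ a₁ ⊔ a₂

/-- Join-preserving approximable relations. -/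
structure ApproxRel.IsJoinPreserving {S T : Type u} [SemilatticeSup S] [OrderBot S] [Proximity S]
    [SemilatticeSup T] [OrderBot T] [Proximity T] (r : ApproxRel S T) : Prop where
  bot : ∀ a, r.rel a ⊥ → a = ⊥
  sup : ∀ a b c, r.rel a (b ⊔ c) → ∃ b' c', a ≤ b' ⊔ c' ∧ r.rel b' b ∧ r.rel c' c

/-- Lawson approximable relations. -/
structure ApproxRel.IsLawson {S T : Type u} [PartialOrder S] [Proximity S]
    [PartialOrder T] [Proximity T] (r : ApproxRel S T) : Prop where
  total : ∀ a a', a ≺ a' → ∃ b, r.rel a b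
  meet : ∀ a a' b c, a ≺ a' → r.rel a' b → r.rel a' c → ∃ d, (d ≺ b ∧ d ≺ c) ∧ r.rel a d

/-- Proximity relations: join-preserving Lawson approximable relations. -/
structure ApproxRel.IsProximityRel {S T : Type u} [SemilatticeSup S] [OrderBot S] [Proximity S]
    [SemilatticeSup T] [OrderBot T] [Proximity T] (r : ApproxRel S T) : Prop where
  join : r.IsJoinPreserving
  lawson : r.IsLawson

variable {S T R : Type u} [SemilatticeSup S] [OrderBot S] [Proximity S]
  [SemilatticeSup T] [OrderBot T] [Proximity T] [SemilatticeSup R] [OrderBot R] [Proximity R]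

theorem isProximityRel_id [IsStrong S] : (ApproxRel.id S).IsProximityRel where
  join := ⟨IsStrong.bot, IsStrong.sup⟩
  lawson := ⟨fun _ a' h => ⟨a', h⟩, fun _ a' _ _ h hb hc => ⟨a', ⟨hb, hc⟩, h⟩⟩

theorem ApproxRel.IsProximityRel.comp {r : ApproxRel S T} {s : ApproxRel T R}
    (hr : r.IsProximityRel) (hs : s.IsProximityRel) : (r.comp s).IsProximityRel where
  join := by
    constructor
    · rintro a ⟨b, hab, hb⟩
      rw [hs.join.bot b hb] at hab
      exact hr.join.bot a hab
    · rintro a c d ⟨b, hab, hb⟩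
      obtain ⟨c', d', hle, hc, hd⟩ := hs.join.sup b c d hb
      obtain ⟨x, y, hle', hx, hy⟩ := hr.join.sup a c' d' (r.up hab hle)
      exact ⟨x, y, hle', ⟨c', hx, hc⟩, ⟨d', hy, hd⟩⟩
  lawson := by
    constructor
    · intro a a' h
      obtain ⟨b, hab⟩ := hr.lawson.total a a' h
      obtain ⟨b', hb, hab'⟩ := r.right.1 hab
      obtain ⟨c, hc⟩ := hs.lawson.total b' b hb
      exact ⟨c, b', hab', hc⟩
    · rintro a a' b c h ⟨x, hx, hxb⟩ ⟨y, hy, hyc⟩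
      obtain ⟨a₁, h1, h2⟩ := prec_interp h
      obtain ⟨d, ⟨hdx, hdy⟩, had⟩ := hr.lawson.meet a₁ a' x y h2 hx hy
      obtain ⟨d', hd, had'⟩ := r.right.1 had
      obtain ⟨e, he, hde⟩ := hs.lawson.meet d' d b c hd (s.left.2 ⟨x, hdx, hxb⟩)
        (s.left.2 ⟨y, hdy, hyc⟩)
      exact ⟨e, he, d', r.left.2 ⟨a₁, h1, had'⟩, hde⟩

end Localized

/-- The objects of `LSPxJLat`: localized strong proximity join-semilattices. -/
structure LSPxJLat : Type (u + 1) where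
  carrier : Type u
  [sup : SemilatticeSup carrier]
  [bot : OrderBot carrier]
  [prox : Proximity carrier]
  [strong : IsStrong carrier]
  [localized : IsLocalized carrier]

attribute [instance] LSPxJLat.sup LSPxJLat.bot LSPxJLat.prox LSPxJLat.strong LSPxJLat.localized

/-- The category `LSPxJLat` of localized strong proximity join-semilattices and proximity
relations, with the relation `≺` as identity and relational composition. -/
instance : Category LSPxJLat.{u} where
  Hom S T := {r : ApproxRel S.carrier T.carrier // r.IsProximityRel}
  id S := ⟨ApproxRel.id S.carrier, isProximityRel_id⟩
  comp r s := ⟨r.1.comp s.1, r.2.comp s.2⟩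
  id_comp {S T} r := Subtype.ext (Category.id_comp (X := PxPos.mk S.carrier)
    (Y := PxPos.mk T.carrier) r.1)
  comp_id {S T} r := Subtype.ext (Category.comp_id (X := PxPos.mk S.carrier)
    (Y := PxPos.mk T.carrier) r.1)
  assoc {S T R Q} r s t := Subtype.ext (Category.assoc (W := PxPos.mk S.carrier)
    (X := PxPos.mk T.carrier) (Y := PxPos.mk R.carrier) (Z := PxPos.mk Q.carrier) r.1 s.1 t.1)

/-- A morphism `X ⟶ G X` is a coalgebra structure for the comonad `G`. -/
structure IsCoalgebraStructure {C : Type u} [Category.{v} C] (G : Comonad C) (X : C)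
    (α : X ⟶ G.obj X) : Prop where
  counit : α ≫ G.ε.app X = 𝟙 X
  coassoc : α ≫ G.δ.app X = α ≫ G.map α

end Prox

namespace Prox

/-! ### Rounded ideals -/

namespace IsRoundedIdeal

variable {S : Type u} [PartialOrder S] [Proximity S] {I : Set S}

/-! Read a finite set in `Lower S` as a formal join of its members, and a finite set in `Upper
(Lower S)` as a formal meet of formal joins. An arrow `α` from `S` to `Upper (Lower S)` says which
elements approximate such an expression. The counit law fixes the value of the one-letter expression
`{{c}}`. Coassociativity says that an expression nested twice may be evaluated from the inside, or
first flattened to a meet of joins by the distributive law.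

Two consequences determine `α`. A formal meet is evaluated as an intersection, up to rounding
(`Double.IsCoalg.rel_iff`), and a formal join as the least rounded ideal containing whatever
approximates one of its members (`Double.IsCoalg.mem_of_rel_sing`). So a proximity poset carries at
most one coalgebra structure (`Double.IsCoalg.unique`).

In a strong semilattice formal joins become actual joins, and the only candidate is `locRel`. Its
coassociativity is finite distributivity of meets over joins, stated with rounded ideals because the
meets need not exist as elements. Localization is the single instance `b ∧ (c ∨ d) = (b ∧ c) ∨ (b ∧
d)`: induction recovers the general law from it (`exists_le_sup_meet`, `mem_of_forall_choice`), and
evaluating that instance in a coalgebra gives it back (`Double.IsCoalg.isLocalized`).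

A coalgebra homomorphism respects the evaluation of formal expressions. Joins give the
join-preserving half of a proximity relation, empty and binary meets the Lawson half, so the functor
to coalgebras is full and faithful. For essential surjectivity, the carrier of a coalgebra may lack
joins, but in `PxPos` it is isomorphic to the poset `RIdl` of its rounded ideals, where `α` supplies
them. The structure transported there makes `RIdl` localized, and by uniqueness it is `locRel`. -/

theorem down (hI : IsRoundedIdeal Proximity.prec I) {a b : S} (h : a ≤ b) (hb : b ∈ I) : a ∈ I :=
  hI.1.IsLowerSet h hb

theorem mem_of_prec (hI : IsRoundedIdeal Proximity.prec I) {a b : S} (h : a ≺ b) (hb : b ∈ I) :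
    a ∈ I := (hI.2 a).2 ⟨b, h, hb⟩

theorem exists_prec (hI : IsRoundedIdeal Proximity.prec I) {a : S} (ha : a ∈ I) :
    ∃ b, a ≺ b ∧ b ∈ I := (hI.2 a).1 ha

theorem exists_upper (hI : IsRoundedIdeal Proximity.prec I) (A : Finset S)
    (h : ∀ a ∈ A, a ∈ I) : ∃ b ∈ I, ∀ a ∈ A, a ≤ b := by
  classical
  induction A using Finset.induction_on with
  | empty =>
    obtain ⟨b, hb⟩ := hI.1.Nonempty
    exact ⟨b, hb, by simp⟩
  | insert x A _ ih =>
    obtain ⟨b, hb, hA⟩ := ih fun a ha => h a (Finset.mem_insert_of_mem ha)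
    obtain ⟨c, hc, h1, h2⟩ := hI.1.Directed b hb x (h x (Finset.mem_insert_self _ _))
    refine ⟨c, hc, fun a ha => ?_⟩
    rcases Finset.mem_insert.1 ha with rfl | ha
    · exact h2
    · exact (hA a ha).trans h1

theorem exists_upper_lower (hI : IsRoundedIdeal Proximity.prec I) (A : Lower S)
    (h : ∀ a, Lower.Mem a A → a ∈ I) : ∃ b ∈ I, A ≤ Lower.mk {b} := by
  obtain ⟨b, hb, hA⟩ := hI.exists_upper (Lower.rep A) fun a ha => h a (Lower.mem_of_rep ha)
  refine ⟨b, hb, Lower.le_iff.2 fun a ha => Lower.mem_sing.2 ?_⟩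
  obtain ⟨c, hc, hac⟩ := Lower.mem_iff.1 ha
  exact hac.trans (hA c hc)

theorem sup_mem {S : Type u} [SemilatticeSup S] [Proximity S] {I : Set S}
    (hI : IsRoundedIdeal Proximity.prec I) {a b : S}
    (ha : a ∈ I) (hb : b ∈ I) :
    a ⊔ b ∈ I := by
  obtain ⟨c, hc, h1, h2⟩ := hI.1.Directed a ha b hb
  exact hI.down (sup_le h1 h2) hc

end IsRoundedIdeal

theorem sup_prec {S : Type u} [SemilatticeSup S] [Proximity S] {a b c : S} (h : a ≺ c)
    (h' : b ≺ c) : a ⊔ b ≺ c :=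
  IsRoundedIdeal.sup_mem (Proximity.prec_ideal c) h h'

/-! ### Coalgebra structures of the double powerlocale -/

section Order

variable {S T : Type u} [PartialOrder S] [PartialOrder T]

theorem Upper.fmap_sing {h : S → T} (hh : Monotone h) (a : S) :
    Upper.fmap h (Upper.mk {a}) = Upper.mk {h a} := by
  refine Upper.ext_mem fun b => ?_
  simp only [Upper.mem_fmap hh, Upper.mem_sing]
  exact ⟨fun ⟨c, hc, hb⟩ => (hh hc).trans hb, fun hb => ⟨a, le_rfl, hb⟩⟩

namespace Double

/-- The function that induces the comultiplication of the double powerlocale. -/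
noncomputable def flatten (W : Upper (Lower (Upper (Lower S)))) : Upper (Lower S) :=
  Upper.fmap Lower.join (Upper.join (Upper.fmap starMap W))

/-- `Z` is a formal join of meets `Y`, and `V` contains a choice of one factor `A` from each `Y`.
Distributivity turns `Z` into the meet, over all such choices, of the joins of the chosen factors;
superfluous members of `V` only enlarge the join. -/
theorem mem_flatten {W : Upper (Lower (Upper (Lower S)))} {X : Lower S} :
    Upper.Mem X (flatten W) ↔ ∃ Z, Upper.Mem Z W ∧ ∃ V : Lower (Lower S),
      (∀ Y, Lower.Mem Y Z → ∃ A, Lower.Mem A V ∧ Upper.Mem A Y) ∧ Lower.join V ≤ X := by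
  simp only [flatten, Upper.mem_fmap Lower.join_mono, Upper.mem_join,
    Upper.mem_fmap starMap_mono]
  constructor
  · rintro ⟨V, ⟨Y, ⟨Z, hZ, hY⟩, hV⟩, hX⟩
    exact ⟨Z, hZ, V, mem_starMap.1 (Upper.le_iff.1 hY V hV), hX⟩
  · rintro ⟨Z, hZ, V, hV, hX⟩
    exact ⟨V, ⟨starMap Z, ⟨Z, hZ, le_rfl⟩, mem_starMap.2 hV⟩, hX⟩

end Double

end Order

section Coalgebra

variable {S T : Type u} [PartialOrder S] [Proximity S] [PartialOrder T] [Proximity T]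

namespace Double

/-- The action of the double powerlocale on approximable relations. -/
theorem map_iff {r : ApproxRel S T} {U : Upper (Lower S)} {V : Upper (Lower T)} :
    (Upper.map (Lower.map r)).rel U V ↔ ∀ B, Upper.Mem B V → ∃ A, Upper.Mem A U ∧
      ∀ a, Lower.Mem a A → ∃ b, Lower.Mem b B ∧ r.rel a b := by
  simp only [Upper.map_iff, Lower.map_iff]

/-- The coalgebra laws of the double powerlocale in terms of elements. -/
structure IsCoalg (α : ApproxRel S (Upper (Lower S))) : Prop where
  counit : ∀ a c, α.rel a (Upper.mk {Lower.mk {c}}) ↔ a ≺ c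
  coassoc : ∀ a W, α.rel a (flatten W) ↔
    ∃ U, α.rel a U ∧ (Upper.map (Lower.map α)).rel U W

/-- Both counits have the form `a ≺ h b`, and composing with such a relation substitutes `h` in the
second argument. Here the two singleton maps are substituted. -/
theorem comp_counit_rel (α : ApproxRel S (Upper (Lower S))) {a c : S} :
    (α.comp ((Upper.map (Lower.counit S)).comp (Upper.counit S))).rel a c ↔
      α.rel a (Upper.mk {Lower.mk {c}}) := by
  -- Associativity is borrowed from `PxPos`, whose composition is definitionally `ApproxRel.comp`.
  have e : α.comp ((Upper.map (Lower.counit S)).comp (Upper.counit S)) =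
      (α.comp (Upper.map (Lower.counit S))).comp (Upper.counit S) :=
    (Category.assoc (W := PxPos.mk S) (X := PxPos.mk (Upper (Lower S)))
      (Y := PxPos.mk (Upper S)) (Z := PxPos.mk S) _ _ _).symm
  rw [e, ← Upper.fmap_sing Lower.sing_mono]
  exact ApproxRel.comp_ofMap_rel.trans Upper.comp_map_ofMap_rel

/-- The three factors of the comultiplication again act by substitution, and the substituted
functions compose to `flatten` by definition. -/
theorem comp_comult_rel (α : ApproxRel S (Upper (Lower S))) {a : S}
    {W : Upper (Lower (Upper (Lower S)))} :
    (α.comp ((Upper.map (Lower.comult S)).comp ((Upper.comult (Lower (Lower S))).comp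
      (Upper.map (sigma (Lower S)))))).rel a W ↔ α.rel a (flatten W) := by
  have e : α.comp ((Upper.map (Lower.comult S)).comp ((Upper.comult (Lower (Lower S))).comp
      (Upper.map (sigma (Lower S))))) =
      ((α.comp (Upper.map (Lower.comult S))).comp (Upper.comult (Lower (Lower S)))).comp
        (Upper.map (sigma (Lower S))) :=
    ((Category.assoc (W := PxPos.mk S) (X := PxPos.mk (Upper (Lower (Lower S))))
      (Y := PxPos.mk (Upper (Upper (Lower (Lower S)))))
      (Z := PxPos.mk (Upper (Lower (Upper (Lower S))))) _ _ _).trans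
    (Category.assoc (W := PxPos.mk S) (X := PxPos.mk (Upper (Lower S)))
      (Y := PxPos.mk (Upper (Lower (Lower S))))
      (Z := PxPos.mk (Upper (Lower (Upper (Lower S))))) _ _ _)).symm
  rw [e]
  exact Upper.comp_map_ofMap_rel.trans
    (ApproxRel.comp_ofMap_rel.trans Upper.comp_map_ofMap_rel)

theorem isCoalgebraStructure_iff (α : ApproxRel S (Upper (Lower S))) :
    IsCoalgebraStructure doublePowerlocale (PxPos.mk S) α ↔ IsCoalg α := by
  constructor
  · intro h
    constructor
    · intro a c
      rw [← comp_counit_rel]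
      exact iff_of_eq (congrArg (fun r : ApproxRel S S => r.rel a c) h.counit)
    · intro a W
      rw [← comp_comult_rel]
      exact iff_of_eq (congrArg (fun r : ApproxRel S (Upper (Lower (Upper (Lower S)))) =>
        r.rel a W) h.coassoc)
  · intro h
    constructor
    · exact ApproxRel.ext_iff_rel (S := S) (T := S)
        fun a c => (comp_counit_rel α).trans (h.counit a c)
    · exact ApproxRel.ext_iff_rel (S := S) (T := Upper (Lower (Upper (Lower S))))
        fun a W => (comp_comult_rel α).trans (h.coassoc a W)

namespace IsCoalg

variable {α : ApproxRel S (Upper (Lower S))}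

/-- Coassociativity at an expression with trivial inner layers shows that `α` takes formal meets to
intersections; `a'` accounts for the rounding. -/
theorem rel_iff (hα : IsCoalg α) {a : S} {U : Upper (Lower S)} :
    α.rel a U ↔ ∃ a', a ≺ a' ∧ ∀ A, Upper.Mem A U → α.rel a' (Upper.mk {A}) := by
  constructor
  · intro h
    obtain ⟨a', h1, h2⟩ := α.left.1 h
    exact ⟨a', h1, fun A hA => α.up h2 hA⟩
  · rintro ⟨a', h1, h2⟩
    have hm : Monotone fun A : Lower S => Lower.mk {Upper.mk {A}} :=
      fun A B h => Lower.sing_mono (Upper.sing_mono h)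
    -- The expression is the meet over `A` in `U` of `{{A}}`, and it flattens to something below
    -- `U`. The intermediate expression `{{a'}}` serves all `A` at once, since everything below `a'`
    -- is related to each `{A}`.
    have hW : α.rel a (flatten (Upper.fmap (fun A => Lower.mk {Upper.mk {A}}) U)) := by
      refine (hα.coassoc _ _).2 ⟨Upper.mk {Lower.mk {a'}}, (hα.counit _ _).2 h1,
        map_iff.2 fun Z hZ => ?_⟩
      obtain ⟨A, hA, hZ⟩ := (Upper.mem_fmap hm).1 hZ
      exact ⟨Lower.mk {a'}, Upper.mem_sing.2 le_rfl, fun c hc => ⟨Upper.mk {A}, hZ,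
        α.down (Lower.mem_sing.1 hc) (h2 A hA)⟩⟩
    refine α.up hW (Upper.le_iff.2 fun A hA => mem_flatten.2
      ⟨Lower.mk {Upper.mk {A}}, (Upper.mem_fmap hm).2 ⟨A, hA, le_rfl⟩, Lower.mk {A},
        fun Y hY => ⟨A, Lower.mem_sing.2 le_rfl, Lower.mem_sing.1 hY⟩, ?_⟩)
    refine Lower.le_iff.2 fun x hx => ?_
    obtain ⟨B, hB, hx⟩ := Lower.mem_join.1 hx
    exact Lower.le_iff.1 (Lower.mem_sing.1 hB) x hx

/-- The elements related to `{A}` form the least rounded ideal that contains all elements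
approximating a member of `A`. -/
theorem mem_of_rel_sing (hα : IsCoalg α) {a : S} {A : Lower S} {I : Set S}
    (hI : IsRoundedIdeal Proximity.prec I)
    (hA : ∀ c, Lower.Mem c A → ∀ d, d ≺ c → d ∈ I) (h : α.rel a (Upper.mk {A})) : a ∈ I := by
  -- Roundedness shrinks `{A}` until some `A' ≺ A` appears. All members of `A'` lie in `I` and have
  -- a common bound `z` there, so the counit law gives `a ≺ z`.
  obtain ⟨U, hU, haU⟩ := α.right.1 h
  obtain ⟨A', hA', hlt⟩ := Upper.prec_iff.1 hU A (Upper.mem_sing.2 le_rfl)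
  obtain ⟨z, hz, hle⟩ := hI.exists_upper_lower A' fun d hd => by
    obtain ⟨c, hc, hdc⟩ := Lower.prec_iff.1 hlt d hd
    exact hA c hc d hdc
  exact hI.mem_of_prec ((hα.counit _ _).1 (α.up haU (hA'.trans (Upper.sing_mono hle)))) hz

theorem rel_of_mem (hα : IsCoalg α) {a c : S} {A : Lower S} (hc : Lower.Mem c A) (h : a ≺ c) :
    α.rel a (Upper.mk {A}) :=
  α.up ((hα.counit _ _).2 h) (Upper.sing_mono hc)

/-- The values at all `U` are determined by those at the `{A}`, and these are least rounded ideals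
whose description does not mention `α`. -/
theorem unique {β : ApproxRel S (Upper (Lower S))} (hα : IsCoalg α) (hβ : IsCoalg β) :
    α = β := by
  have key : ∀ {α β : ApproxRel S (Upper (Lower S))}, IsCoalg α → IsCoalg β →
      ∀ a U, α.rel a U → β.rel a U := by
    intro α β hα hβ a U h
    obtain ⟨a', h1, h2⟩ := hα.rel_iff.1 h
    exact hβ.rel_iff.2 ⟨a', h1, fun A hA => hα.mem_of_rel_sing (β.ideal (Upper.mk {A}))
      (fun c hc d hd => hβ.rel_of_mem hc hd) (h2 A hA)⟩
  exact ApproxRel.ext_iff_rel fun a U => ⟨key hα hβ a U, key hβ hα a U⟩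

end IsCoalg

end Double

end Coalgebra

/-! ### Finite joins in strong proximity join-semilattices -/

section Semilattice

variable {S T : Type u} [SemilatticeSup S] [OrderBot S] [SemilatticeSup T] [OrderBot T]

/-- The join of (a representative of) a class of finite subsets. -/
noncomputable def Lower.lsup (A : Lower S) : S := (Lower.rep A).sup id

theorem Lower.lsup_le {A : Lower S} {x : S} : lsup A ≤ x ↔ ∀ a, Mem a A → a ≤ x := by
  simp only [lsup, Finset.sup_le_iff, id]
  constructor
  · intro h a ha
    obtain ⟨b, hb, hab⟩ := mem_iff.1 ha
    exact hab.trans (h b hb)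
  · exact fun h a ha => h a (mem_of_rep ha)

theorem Lower.le_lsup {A : Lower S} {a : S} (h : Mem a A) : a ≤ lsup A := lsup_le.1 le_rfl a h

theorem Lower.lsup_mono : Monotone (lsup (S := S)) :=
  fun _ _ h => lsup_le.2 fun a ha => le_lsup (le_iff.1 h a ha)

theorem Lower.lsup_mk {A : Finset S} : lsup (mk A) = A.sup id := by
  refine le_antisymm (lsup_le.2 fun a ha => ?_) (Finset.sup_le fun a ha => le_lsup (mem_mk_of ha))
  obtain ⟨b, hb, hab⟩ := mem_mk.1 ha
  exact hab.trans (Finset.le_sup (f := id) hb)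

theorem Lower.lsup_sing {a : S} : lsup (mk {a}) = a := by simp [lsup_mk]

variable [Proximity S] [Proximity T]

namespace IsRoundedIdeal

variable {I J : Set S}

theorem bot_mem (hI : IsRoundedIdeal Proximity.prec I) : ⊥ ∈ I := by
  obtain ⟨a, ha⟩ := hI.1.Nonempty
  exact hI.down bot_le ha

theorem lsup_mem (hI : IsRoundedIdeal Proximity.prec I) {A : Lower S}
    (h : ∀ a, Lower.Mem a A → a ∈ I) : Lower.lsup A ∈ I := by
  obtain ⟨b, hb, hA⟩ := hI.exists_upper_lower A h
  exact hI.down ((Lower.lsup_mono hA).trans Lower.lsup_sing.le) hb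

/-- The join of two rounded ideals. -/
theorem sup [IsStrong S] (hI : IsRoundedIdeal Proximity.prec I)
    (hJ : IsRoundedIdeal Proximity.prec J) :
    IsRoundedIdeal Proximity.prec {a : S | ∃ x ∈ I, ∃ y ∈ J, a ≤ x ⊔ y} := by
  refine ⟨⟨?_, ⟨⊥, ⊥, hI.bot_mem, ⊥, hJ.bot_mem, bot_le⟩, ?_⟩, fun a => ⟨?_, ?_⟩⟩
  · rintro b a h ⟨x, hx, y, hy, hb⟩
    exact ⟨x, hx, y, hy, h.trans hb⟩
  · rintro a ⟨x, hx, y, hy, ha⟩ b ⟨x', hx', y', hy', hb⟩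
    exact ⟨a ⊔ b, ⟨x ⊔ x', hI.sup_mem hx hx', y ⊔ y', hJ.sup_mem hy hy',
      (sup_le_sup ha hb).trans (sup_sup_sup_comm x y x' y').le⟩, le_sup_left, le_sup_right⟩
  · rintro ⟨x, hx, y, hy, ha⟩
    obtain ⟨x', hxx, hx'⟩ := hI.exists_prec hx
    obtain ⟨y', hyy, hy'⟩ := hJ.exists_prec hy
    refine ⟨x' ⊔ y', le_prec ha ?_, x', hx', y', hy', le_rfl⟩
    exact (Proximity.prec_ideal (x' ⊔ y')).sup_mem (prec_le hxx le_sup_left)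
      (prec_le hyy le_sup_right)
  -- The one place where strength enters: an element approximating `x ⊔ y` is bounded by a join of
  -- approximants of `x` and of `y`.
  · rintro ⟨b, hab, x, hx, y, hy, hb⟩
    obtain ⟨x', y', ha, hxx, hyy⟩ := IsStrong.sup a x y (prec_le hab hb)
    exact ⟨x', hI.mem_of_prec hxx hx, y', hJ.mem_of_prec hyy hy, ha⟩

end IsRoundedIdeal

theorem bot_prec (a : S) : (⊥ : S) ≺ a := IsRoundedIdeal.bot_mem (Proximity.prec_ideal a)

theorem lsup_prec {A : Lower S} {c : S} (h : ∀ a, Lower.Mem a A → a ≺ c) : Lower.lsup A ≺ c :=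
  IsRoundedIdeal.lsup_mem (Proximity.prec_ideal c) h

theorem lsup_prec_lsup {A B : Lower S} (h : A ≺ B) : Lower.lsup A ≺ Lower.lsup B :=
  lsup_prec fun a ha => by
    obtain ⟨b, hb, hab⟩ := Lower.prec_iff.1 h a ha
    exact prec_le hab (Lower.le_lsup hb)

theorem ApproxRel.IsJoinPreserving.exists_le_sup {r : ApproxRel S T} (hr : r.IsJoinPreserving)
    {a : S} {B : Finset T} (h : r.rel a (B.sup _root_.id)) :
    ∃ A : Finset S, a ≤ A.sup _root_.id ∧ ∀ c ∈ A, ∃ b ∈ B, r.rel c b := by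
  classical
  induction B using Finset.induction_on generalizing a with
  | empty => exact ⟨∅, (hr.bot a h).le, by simp⟩
  | insert b B _ ih =>
    rw [Finset.sup_insert] at h
    obtain ⟨b', c', hle, hb, hc⟩ := hr.sup _ _ _ h
    obtain ⟨A, hA, hA'⟩ := ih hc
    refine ⟨insert b' A, ?_, fun c hc => ?_⟩
    · rw [Finset.sup_insert]
      exact hle.trans (sup_le_sup_left hA _)
    · rcases Finset.mem_insert.1 hc with rfl | hc
      · exact ⟨b, Finset.mem_insert_self _ _, hb⟩
      · obtain ⟨b, hb, hcb⟩ := hA' c hc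
        exact ⟨b, Finset.mem_insert_of_mem hb, hcb⟩

theorem ApproxRel.IsJoinPreserving.exists_le_lsup {r : ApproxRel S T} (hr : r.IsJoinPreserving)
    {a : S} {B : Lower T} (h : r.rel a (Lower.lsup B)) :
    ∃ A : Lower S, a ≤ Lower.lsup A ∧ (Lower.map r).rel A B := by
  obtain ⟨A, hA, hA'⟩ := hr.exists_le_sup h
  refine ⟨Lower.mk A, hA.trans Lower.lsup_mk.ge, Lower.map_iff.2 fun c hc => ?_⟩
  obtain ⟨d, hd, hcd⟩ := Lower.mem_mk.1 hc
  obtain ⟨b, hb, hdb⟩ := hA' d hd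
  exact ⟨b, Lower.mem_of_rep hb, r.down hcd hdb⟩

/-- Strength says that `≺` itself is join-preserving, hence splits finite joins; interpolating
beforehand keeps the last relation strict. -/
theorem exists_prec_lsup [IsStrong S] {a : S} {B : Lower S} (h : a ≺ Lower.lsup B) :
    ∃ A, A ≺ B ∧ a ≺ Lower.lsup A := by
  obtain ⟨b, hab, hb⟩ := prec_interp h
  obtain ⟨A, hA, hAB⟩ := (isProximityRel_id (S := S)).join.exists_le_lsup hb
  exact ⟨A, hAB, prec_le hab hA⟩

/-! ### The coalgebra of a localized strong proximity join-semilattice -/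

/-- The element `a` is related to the finite set `U` if it approximates the meet of the joins
of the members of `U`. -/
def locRel (S : Type u) [SemilatticeSup S] [OrderBot S] [Proximity S] [IsStrong S] :
    ApproxRel S (Upper (Lower S)) where
  -- A finite intersection of rounded ideals need not be rounded, and `b` cuts it down to its
  -- rounded part. For empty `U` this leaves the elements that approximate something.
  rel a U := ∃ b, a ≺ b ∧ ∀ A, Upper.Mem A U → b ≺ Lower.lsup A
  ideal U := by
    refine ⟨⟨?_, ⟨⊥, ⊥, bot_prec _, fun A _ => bot_prec _⟩, ?_⟩, fun a => ⟨?_, ?_⟩⟩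
    · rintro a a' h ⟨b, hab, hb⟩
      exact ⟨b, le_prec h hab, hb⟩
    · rintro a ⟨b, hab, hb⟩ a' ⟨b', hab', hb'⟩
      exact ⟨a ⊔ a', ⟨b ⊔ b', sup_prec (prec_le hab le_sup_left) (prec_le hab' le_sup_right),
        fun A hA => sup_prec (hb A hA) (hb' A hA)⟩, le_sup_left, le_sup_right⟩
    · rintro ⟨b, hab, hb⟩
      obtain ⟨c, hac, hcb⟩ := prec_interp hab
      exact ⟨c, hac, b, hcb, hb⟩
    · rintro ⟨c, hac, b, hcb, hb⟩
      exact ⟨b, prec_trans hac hcb, hb⟩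
  upper a := by
    refine ⟨?_, fun U => ⟨?_, ?_⟩⟩
    · rintro U U' h ⟨b, hab, hb⟩
      exact ⟨b, hab, fun A hA => hb A (Upper.le_iff.1 h A hA)⟩
    · rintro ⟨b, hab, hb⟩
      obtain ⟨B, hB, hB'⟩ := exists_finset_choice (Upper.rep U)
        fun A hA => exists_prec_lsup (hb A (Upper.mem_of_rep hA))
      refine ⟨Upper.mk B, Upper.prec_iff.2 fun A hA => ?_, b, hab, fun A hA => ?_⟩
      · obtain ⟨A', hA', hle⟩ := Upper.mem_iff.1 hA
        obtain ⟨C, hC, hCA, -⟩ := hB A' hA'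
        exact ⟨C, Upper.mem_mk_of hC, prec_le hCA hle⟩
      · obtain ⟨C, hC, hle⟩ := Upper.mem_mk.1 hA
        obtain ⟨_, _, _, h⟩ := hB' C hC
        exact prec_le h (Lower.lsup_mono hle)
    · rintro ⟨U', hU, b, hab, hb⟩
      refine ⟨b, hab, fun A hA => ?_⟩
      obtain ⟨A', hA', hlt⟩ := Upper.prec_iff.1 hU A hA
      exact prec_trans (hb A' hA') (lsup_prec_lsup hlt)

theorem locRel_sing [IsStrong S] {a : S} {A : Lower S} :
    (locRel S).rel a (Upper.mk {A}) ↔ a ≺ Lower.lsup A := by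
  constructor
  · rintro ⟨b, hab, hb⟩
    exact prec_trans hab (hb A (Upper.mem_sing.2 le_rfl))
  · intro h
    obtain ⟨b, hab, hb⟩ := prec_interp h
    exact ⟨b, hab, fun B hB => prec_le hb (Lower.lsup_mono (Upper.mem_sing.1 hB))⟩

/-! ### Finite distributivity in localized semilattices -/

section Localized

variable [IsStrong S] [IsLocalized S]

/-- Since `≺` is not assumed to imply `≤`, strength first bounds `b` by a join `c' ⊔ d'` of
approximants, to which localization applies. -/
theorem exists_localized {a b c d : S} (hab : a ≺ b) (hb : b ≺ c ⊔ d) :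
    ∃ x y, (x ≺ b ∧ x ≺ c) ∧ (y ≺ b ∧ y ≺ d) ∧ a ≺ x ⊔ y := by
  obtain ⟨c', d', hle, hc, hd⟩ := IsStrong.sup b c d hb
  obtain ⟨x, y, ⟨hxb, hxc⟩, ⟨hyb, hyd⟩, h⟩ := IsLocalized.localized a b c' d' hab hle
  exact ⟨x, y, ⟨hxb, prec_trans hxc hc⟩, ⟨hyb, prec_trans hyd hd⟩, h⟩

/-- If `b` lies below `I ∨ y` for all `y ∈ Y`, then `b` lies below `I ∨ ⋀ Y`. -/
theorem exists_le_sup_meet {I : Set S} (hI : IsRoundedIdeal Proximity.prec I) {ι : Type u}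
    (f : ι → S) (Y : Finset ι) {a b : S} (hab : a ≺ b)
    (h : ∀ i ∈ Y, ∃ x ∈ I, ∃ y, y ≺ f i ∧ b ≤ x ⊔ y) :
    ∃ x ∈ I, ∃ y, y ≺ b ∧ (∀ i ∈ Y, y ≺ f i) ∧ a ≤ x ⊔ y := by
  classical
  induction Y using Finset.induction_on generalizing a with
  | empty => exact ⟨⊥, hI.bot_mem, a, hab, by simp, le_sup_right⟩
  | insert i Y _ ih =>
    obtain ⟨a', haa, hab'⟩ := prec_interp hab
    obtain ⟨x, hx, v, hvb, hvY, ha'⟩ := ih hab' fun i hi => h i (Finset.mem_insert_of_mem hi)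
    obtain ⟨x₁, v₁, ha, hx₁, hv₁⟩ := IsStrong.sup a x v (prec_le haa ha')
    obtain ⟨x₂, hx₂, y, hy, hb⟩ := h i (Finset.mem_insert_self _ _)
    -- Because `v ≺ b` was carried through the induction, `v` is covered by `x₂ ⊔ y` and can be
    -- localized. The part below `x₂` is absorbed by `I`; the part below `y` approximates `f i` as
    -- well as everything that `v` does.
    obtain ⟨s, t, ⟨hsv, hsx⟩, ⟨htv, hty⟩, hst⟩ := exists_localized hv₁ (prec_le hvb hb)
    obtain ⟨s', t', hv₁', hs', ht'⟩ := IsStrong.sup _ _ _ hst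
    refine ⟨x₁ ⊔ s', hI.sup_mem (hI.mem_of_prec hx₁ hx)
      (hI.mem_of_prec (prec_trans hs' hsx) hx₂), t', prec_trans ht' (prec_trans htv hvb), ?_, ?_⟩
    · intro j hj
      rcases Finset.mem_insert.1 hj with rfl | hj
      · exact prec_trans ht' (prec_trans hty hy)
      · exact prec_trans ht' (prec_trans htv (hvY j hj))
    · exact ha.trans ((sup_le_sup_left hv₁' _).trans (sup_assoc _ _ _).ge)

/-- Distributivity of finite meets of finite joins over each other, for rounded ideals. -/
theorem mem_of_forall_choice {ι : Type u} (f : ι → S) (Z : Finset (Finset ι)) {I : Set S}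
    (hI : IsRoundedIdeal Proximity.prec I)
    (hZ : ∀ Y ∈ Z, ∀ a b, a ≺ b → (∀ i ∈ Y, b ≺ f i) → a ∈ I) {a b : S} (hab : a ≺ b)
    (h : ∀ B : Finset ι, (∀ Y ∈ Z, ∃ i ∈ Y, i ∈ B) →
      ∃ x ∈ I, ∃ y, y ≺ B.sup f ∧ b ≤ x ⊔ y) : a ∈ I := by
  classical
  induction Z using Finset.induction_on generalizing I a with
  | empty =>
    -- With nothing to choose from, the empty choice is allowed; its join is `⊥`, so `b` lies below
    -- an element of `I`.
    obtain ⟨x, hx, y, hy, hb⟩ := h ∅ (by simp)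
    rw [IsStrong.bot y (by simpa using hy), sup_bot_eq] at hb
    exact hI.mem_of_prec (prec_le hab hb) hx
  | insert Y Z _ ih =>
    obtain ⟨a₁, haa, hab₁⟩ := prec_interp hab
    obtain ⟨a₂, haa₂, hab₂⟩ := prec_interp haa
    have h' : ∀ i ∈ Y, ∃ x ∈ I, ∃ y, y ≺ f i ∧ a₁ ≤ x ⊔ y := by
      intro i hi
      -- Adjoining `f i` to the ideal fixes the choice `i` from `Y`: a choice `B` for `Z` extends to
      -- `insert i B`, and the extra summand `f i` is absorbed by the larger ideal.
      refine ih (hI.sup (Proximity.prec_ideal (f i))) ?_ hab₁ ?_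
      · exact fun Y' hY' c d hcd hd => ⟨c, hZ Y' (Finset.mem_insert_of_mem hY') c d hcd hd, ⊥,
          bot_prec _, le_sup_left⟩
      · intro B hB
        obtain ⟨x, hx, y, hy, hb⟩ := h (insert i B) fun Y' hY' => by
          rcases Finset.mem_insert.1 hY' with rfl | hY'
          · exact ⟨i, hi, Finset.mem_insert_self _ _⟩
          · obtain ⟨j, hj, hjB⟩ := hB Y' hY'
            exact ⟨j, hj, Finset.mem_insert_of_mem hjB⟩
        rw [Finset.sup_insert] at hy
        obtain ⟨y₁, y₂, hle, hy₁, hy₂⟩ := IsStrong.sup _ _ _ hy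
        exact ⟨x ⊔ y₁, ⟨x, hx, y₁, hy₁, le_rfl⟩, y₂, hy₂,
          hb.trans ((sup_le_sup_left hle _).trans (sup_assoc _ _ _).ge)⟩
    obtain ⟨x, hx, y, -, hy, hle⟩ := exists_le_sup_meet hI f Y hab₂ h'
    -- `y` approximates every `f i` with `i ∈ Y`, so anything approximating `y` lies in `I` by `hZ`.
    obtain ⟨x', y', ha, hx', hy'⟩ := IsStrong.sup _ _ _ (prec_le haa₂ hle)
    exact hI.down ha (hI.sup_mem (hI.mem_of_prec hx' hx)
      (hZ Y (Finset.mem_insert_self _ _) y' y hy' hy))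

-- From nested evaluation to the flattened expression, monotonicity of joins and transitivity
-- suffice. Conversely, an element below the flattened expression is below the join of every choice,
-- and `mem_of_forall_choice` turns this meet of joins into a join of meets, separately for each
-- representative `Z` of `W`.
open Double in
theorem Double.isCoalg_locRel : IsCoalg (locRel S) where
  counit a c := by rw [locRel_sing, Lower.lsup_sing]
  coassoc a W := by
    classical
    constructor
    · rintro ⟨b, hab, hb⟩
      -- In the chain `a ≺ b₂ ≺ b₁ ≺ b`, distributivity at `b` bounds `b₁` by joins, and `b₂` is
      -- then the witness that `a` is related to `U`.
      obtain ⟨b₁, hab₁, hbb⟩ := prec_interp hab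
      obtain ⟨b₂, hab₂, hbb₂⟩ := prec_interp hab₁
      have key : ∀ Z ∈ Upper.rep W, ∃ A : Lower S, b₁ ≤ Lower.lsup A ∧
          ∀ c, Lower.Mem c A → ∃ Y, Lower.Mem Y Z ∧ (locRel S).rel c Y := by
        intro Z hZ
        -- The ideal is the value of the formal join `Z`: what is bounded by a finite join of
        -- elements, each related to one of the meets `Y` in `Z`.
        refine mem_of_forall_choice Lower.lsup ((Lower.rep Z).image Upper.rep)
          (I := {x | ∃ A : Lower S, x ≤ Lower.lsup A ∧
            ∀ c, Lower.Mem c A → ∃ Y, Lower.Mem Y Z ∧ (locRel S).rel c Y}) ?_ ?_ hbb ?_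
        · refine ⟨⟨?_, ⟨⊥, Lower.mk ∅, bot_le, fun c hc => by simp [Lower.mem_mk] at hc⟩, ?_⟩,
            fun x => ⟨?_, ?_⟩⟩
          · rintro y x h ⟨A, hA, h'⟩
            exact ⟨A, h.trans hA, h'⟩
          · rintro x ⟨A, hA, h⟩ y ⟨B, hB, h'⟩
            refine ⟨x ⊔ y, ⟨Lower.mk (Lower.rep A ∪ Lower.rep B), ?_, fun c hc => ?_⟩,
              le_sup_left, le_sup_right⟩
            · rw [Lower.lsup_mk, Finset.sup_union]
              exact sup_le_sup hA hB
            · obtain ⟨d, hd, hcd⟩ := Lower.mem_mk.1 hc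
              rcases Finset.mem_union.1 hd with hd | hd
              · exact h c (Lower.mem_iff.2 ⟨d, hd, hcd⟩)
              · exact h' c (Lower.mem_iff.2 ⟨d, hd, hcd⟩)
          · rintro ⟨A, hA, h⟩
            obtain ⟨B, hAB, hB⟩ := (Lower.map (locRel S)).left.1 (Lower.map_iff.2 h)
            exact ⟨Lower.lsup B, le_prec hA (lsup_prec_lsup hAB), B, le_rfl,
              Lower.map_iff.1 hB⟩
          · rintro ⟨y, hxy, A, hA, h⟩
            obtain ⟨B, hBA, hxB⟩ := exists_prec_lsup (prec_le hxy hA)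
            obtain ⟨C, hC, hCB⟩ := (isProximityRel_id (S := S)).join.exists_le_lsup hxB
            exact ⟨C, hC, Lower.map_iff.1 ((Lower.map (locRel S)).left.2
              ⟨A, prec_trans hCB hBA, Lower.map_iff.2 h⟩)⟩
        · intro Y' hY' c d hcd hd
          obtain ⟨Y, hY, rfl⟩ := Finset.mem_image.1 hY'
          refine ⟨Lower.mk {c}, Lower.lsup_sing.ge, fun e he => ⟨Y, Lower.mem_of_rep hY,
            (locRel S).down (Lower.mem_sing.1 he) ⟨d, hcd, fun A hA => ?_⟩⟩⟩
          obtain ⟨A', hA', hle⟩ := Upper.mem_iff.1 hA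
          exact prec_le (hd A' hA') (Lower.lsup_mono hle)
        · intro B hB
          -- No contribution from the ideal is needed: the union of the choice `B` is a factor of
          -- `flatten W`, so `b` itself approximates its join.
          refine ⟨⊥, ⟨Lower.mk ∅, bot_le, fun c hc => by simp [Lower.mem_mk] at hc⟩, b, ?_,
            le_sup_right⟩
          refine prec_le (hb (Lower.join (Lower.mk B)) (mem_flatten.2 ⟨Z, Upper.mem_of_rep hZ,
            Lower.mk B, fun Y hY => ?_, le_rfl⟩)) (Lower.lsup_le.2 fun x hx => ?_)
          · obtain ⟨Y', hY', hle⟩ := Lower.mem_iff.1 hY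
            obtain ⟨A, hA, hAB⟩ := hB _ (Finset.mem_image_of_mem _ hY')
            exact ⟨A, Lower.mem_mk_of hAB, Upper.le_iff.1 hle A (Upper.mem_of_rep hA)⟩
          · obtain ⟨A, hA, hxA⟩ := Lower.mem_join.1 hx
            obtain ⟨C, hC, hAC⟩ := Lower.mem_mk.1 hA
            exact (Lower.le_lsup (Lower.le_iff.1 hAC x hxA)).trans (Finset.le_sup hC)
      obtain ⟨U, hU, hU'⟩ := exists_finset_choice _ key
      refine ⟨Upper.mk U, ⟨b₂, hab₂, fun A hA => ?_⟩, map_iff.2 fun Z hZ => ?_⟩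
      · obtain ⟨A', hA', hle⟩ := Upper.mem_mk.1 hA
        obtain ⟨_, _, h, -⟩ := hU' A' hA'
        exact prec_le hbb₂ (h.trans (Lower.lsup_mono hle))
      · obtain ⟨Z', hZ', hle⟩ := Upper.mem_iff.1 hZ
        obtain ⟨A, hA, -, h⟩ := hU Z' hZ'
        refine ⟨A, Upper.mem_mk_of hA, fun c hc => ?_⟩
        obtain ⟨Y, hY, hcY⟩ := h c hc
        exact ⟨Y, Lower.le_iff.1 hle Y hY, hcY⟩
    · rintro ⟨U, ⟨b, hab, hb⟩, hU⟩
      refine ⟨b, hab, fun X hX => ?_⟩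
      obtain ⟨Z, hZ, V, hV, hle⟩ := mem_flatten.1 hX
      obtain ⟨A, hA, h⟩ := map_iff.1 hU Z hZ
      refine prec_trans (hb A hA) (lsup_prec fun c hc => ?_)
      obtain ⟨Y, hY, d, hcd, hd⟩ := h c hc
      obtain ⟨B, hBV, hBY⟩ := hV Y hY
      exact prec_trans hcd (prec_le (hd B hBY) (Lower.lsup_mono
        ((Lower.le_iff.2 fun x hx => Lower.mem_join.2 ⟨B, hBV, hx⟩ : B ≤ Lower.join V).trans hle)))

end Localized

end Semilattice

/-- Finite form of the Lawson conditions: totality is the empty meet, and each further element costs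
one interpolation between `a` and `a'`. -/
theorem ApproxRel.IsLawson.exists_lower_bound {S T : Type u} [PartialOrder S] [Proximity S]
    [PartialOrder T] [Proximity T] {r : ApproxRel S T} (hr : r.IsLawson)
    {a a' : S} (h : a ≺ a') (B : Finset T) (hB : ∀ b ∈ B, r.rel a' b) :
    ∃ d, r.rel a d ∧ ∀ b ∈ B, d ≺ b := by
  classical
  induction B using Finset.induction_on generalizing a with
  | empty =>
    obtain ⟨d, hd⟩ := hr.total a a' h
    exact ⟨d, hd, by simp⟩
  | insert b B _ ih =>
    obtain ⟨a₁, h1, h2⟩ := prec_interp h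
    obtain ⟨d, hd, hdB⟩ := ih h2 fun b hb => hB b (Finset.mem_insert_of_mem hb)
    have hb := r.left.2 ⟨a', h2, hB b (Finset.mem_insert_self _ _)⟩
    obtain ⟨e, ⟨heb, hed⟩, hae⟩ := hr.meet a a₁ b d h1 hb hd
    refine ⟨e, hae, fun c hc => ?_⟩
    rcases Finset.mem_insert.1 hc with rfl | hc
    · exact heb
    · exact prec_trans hed (hdB c hc)

/-! ### Localization from a coalgebra structure -/

section Semilattice

variable {S T : Type u} [SemilatticeSup S] [OrderBot S] [Proximity S]
  [SemilatticeSup T] [OrderBot T] [Proximity T]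

-- One instance of distributivity is evaluated: `a` lies below `b ∧ (c ∨ d)`, hence below the
-- flattening of `(b ∧ c) ∨ (b ∧ d)`. Coassociativity yields a finite set `A` whose join bounds `a`
-- and whose members lie below `b ∧ c` or `b ∧ d`; collecting the two kinds gives the required pair.
open Double in
theorem Double.IsCoalg.isLocalized [IsStrong S] {α : ApproxRel S (Upper (Lower S))}
    (hα : IsCoalg α) : IsLocalized S where
  localized a b c d hab hb := by
    classical
    obtain ⟨a', haa, hab'⟩ := prec_interp hab
    -- The formal expression `(b ∧ c) ∨ (b ∧ d)`, as a meet with a single factor.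
    let W : Upper (Lower (Upper (Lower S))) := Upper.mk {Lower.mk
      {Upper.mk {Lower.mk {b}, Lower.mk {c}}, Upper.mk {Lower.mk {b}, Lower.mk {d}}}}
    have h : α.rel a (Upper.mk {Lower.mk {b}, Lower.mk {c, d}}) := by
      refine hα.rel_iff.2 ⟨a', haa, fun A hA => ?_⟩
      obtain ⟨B, hB, hBA⟩ := Upper.mem_mk.1 hA
      refine α.up ?_ (Upper.sing_mono hBA)
      rcases Finset.mem_insert.1 hB with rfl | hB
      · exact (hα.counit _ _).2 hab'
      · rw [Finset.mem_singleton.1 hB]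
        obtain ⟨c', d', hle, hc, hd⟩ := IsStrong.sup _ _ _ (prec_le hab' hb)
        have hI := α.ideal (Upper.mk {Lower.mk {c, d}})
        exact hI.down hle (hI.sup_mem
          (hα.rel_of_mem (Lower.mem_mk_of (Finset.mem_insert_self _ _)) hc)
          (hα.rel_of_mem (Lower.mem_mk_of (Finset.mem_insert_of_mem
            (Finset.mem_singleton_self _))) hd))
    have hW : α.rel a (flatten W) := by
      -- A choice from the two meets contains `b`, or else both `c` and `d`; so every factor of
      -- `flatten W` lies above `{b}` or `{c, d}`.
      refine α.up h (Upper.le_iff.2 fun X hX => ?_)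
      obtain ⟨Z, hZ, V, hV, hle⟩ := mem_flatten.1 hX
      have hsub : ∀ B, Lower.Mem B V → B ≤ X := fun B hB =>
        (Lower.le_iff.2 fun x hx => Lower.mem_join.2 ⟨B, hB, hx⟩ : B ≤ Lower.join V).trans hle
      have hZ' := Lower.le_iff.1 (Upper.mem_sing.1 hZ)
      obtain ⟨A, hAV, hA⟩ := hV _ (hZ' _ (Lower.mem_mk_of (Finset.mem_insert_self _ _)))
      obtain ⟨B, hBV, hB⟩ := hV _ (hZ' _ (Lower.mem_mk_of
        (Finset.mem_insert_of_mem (Finset.mem_singleton_self _))))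
      obtain ⟨A', hA', hAA⟩ := Upper.mem_mk.1 hA
      obtain ⟨B', hB', hBB⟩ := Upper.mem_mk.1 hB
      rcases Finset.mem_insert.1 hA' with rfl | hA'
      · exact Upper.mem_mk.2 ⟨_, Finset.mem_insert_self _ _, hAA.trans (hsub A hAV)⟩
      rcases Finset.mem_insert.1 hB' with rfl | hB'
      · exact Upper.mem_mk.2 ⟨_, Finset.mem_insert_self _ _, hBB.trans (hsub B hBV)⟩
      rw [Finset.mem_singleton.1 hA'] at hAA
      rw [Finset.mem_singleton.1 hB'] at hBB
      refine Upper.mem_mk.2 ⟨_, Finset.mem_insert_of_mem (Finset.mem_singleton_self _),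
        Lower.mk_le_mk.2 ?_ |>.trans (Lower.mk_rep X).le⟩
      intro x hx
      rcases Finset.mem_insert.1 hx with rfl | hx
      · exact Lower.mem_iff.1 (hAA.trans (hsub A hAV))
      · rw [Finset.mem_singleton.1 hx]
        exact Lower.mem_iff.1 (hBB.trans (hsub B hBV))
    obtain ⟨U, haU, hU⟩ := (hα.coassoc _ _).1 hW
    obtain ⟨A, hAU, hA⟩ := map_iff.1 hU _ (Upper.mem_sing.2 le_rfl)
    have hA' : ∀ x ∈ Lower.rep A, (x ≺ b ∧ x ≺ c) ∨ (x ≺ b ∧ x ≺ d) := by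
      have hprec : ∀ {x y : S} {Y : Finset (Lower S)}, α.rel x (Upper.mk Y) →
          Lower.mk {y} ∈ Y → x ≺ y := fun hx hy =>
        (hα.counit _ _).1 (α.up hx (Upper.mem_mk_of hy))
      intro x hx
      obtain ⟨Y, hY, hxY⟩ := hA x (Lower.mem_of_rep hx)
      obtain ⟨Y', hY', hle⟩ := Lower.mem_mk.1 hY
      have hx' := α.up hxY hle
      rcases Finset.mem_insert.1 hY' with rfl | hY'
      · exact Or.inl ⟨hprec hx' (by simp), hprec hx' (by simp)⟩
      · rw [Finset.mem_singleton.1 hY'] at hx'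
        exact Or.inr ⟨hprec hx' (by simp), hprec hx' (by simp)⟩
    have hsup : ∀ (p : S → Prop) [DecidablePred p] (e : S), (∀ x, p x → x ≺ e) →
        ((Lower.rep A).filter p).sup _root_.id ≺ e := by
      intro p _ e h
      rw [← Lower.lsup_mk]
      refine lsup_prec fun x hx => ?_
      obtain ⟨y, hy, hxy⟩ := Lower.mem_mk.1 hx
      exact le_prec hxy (h y (Finset.mem_filter.1 hy).2)
    refine ⟨((Lower.rep A).filter fun x => x ≺ b ∧ x ≺ c).sup _root_.id,
      ((Lower.rep A).filter fun x => x ≺ b ∧ x ≺ d).sup _root_.id,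
      ⟨hsup (fun x => x ≺ b ∧ x ≺ c) b fun _ => And.left,
        hsup (fun x => x ≺ b ∧ x ≺ c) c fun _ => And.right⟩,
      ⟨hsup (fun x => x ≺ b ∧ x ≺ d) b fun _ => And.left,
        hsup (fun x => x ≺ b ∧ x ≺ d) d fun _ => And.right⟩, ?_⟩
    -- The two collected joins together bound every member of `A`, so the counit law turns the
    -- relation of `a` to `{A}` into the desired `≺`.
    refine (hα.counit _ _).1 (α.up (α.up haU hAU) (Upper.sing_mono (Lower.le_iff.2
      fun x hx => Lower.mem_sing.2 ?_)))
    obtain ⟨y, hy, hxy⟩ := Lower.mem_iff.1 hx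
    refine hxy.trans ?_
    rcases hA' y hy with h | h
    · exact (Finset.le_sup (f := _root_.id) (Finset.mem_filter.2 ⟨hy, h⟩)).trans le_sup_left
    · exact (Finset.le_sup (f := _root_.id) (Finset.mem_filter.2 ⟨hy, h⟩)).trans le_sup_right

/-! ### Proximity relations and coalgebra homomorphisms -/

/-- The Lawson conditions provide one `t` approximating all the joins of members of `V`, which gives
one inclusion. Join preservation pulls each of these joins back to a finite join in `S`, which gives
the other. -/
theorem ApproxRel.IsProximityRel.comp_locRel [IsStrong S] [IsStrong T] {r : ApproxRel S T}
    (hr : r.IsProximityRel) :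
    (locRel S).comp (Upper.map (Lower.map r)) = r.comp (locRel T) := by
  refine ApproxRel.ext_iff_rel fun a V => ⟨?_, ?_⟩
  · rintro ⟨U, ⟨a', haa, ha'⟩, hUV⟩
    obtain ⟨a₁, h1, h2⟩ := prec_interp haa
    classical
    obtain ⟨t, hat, ht⟩ := hr.lawson.exists_lower_bound h2 ((Upper.rep V).image Lower.lsup) <| by
      intro b hb
      obtain ⟨B, hB, rfl⟩ := Finset.mem_image.1 hb
      obtain ⟨A, hA, h⟩ := Double.map_iff.1 hUV B (Upper.mem_of_rep hB)
      refine r.left.2 ⟨_, ha' A hA, (r.ideal _).lsup_mem fun x hx => ?_⟩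
      obtain ⟨b, hb, hxb⟩ := h x hx
      exact r.up hxb (Lower.le_lsup hb)
    obtain ⟨t', htt, hat'⟩ := r.right.1 (r.left.2 ⟨a₁, h1, hat⟩)
    refine ⟨t', hat', t, htt, fun B hB => ?_⟩
    obtain ⟨B', hB', hle⟩ := Upper.mem_iff.1 hB
    exact prec_le (ht _ (Finset.mem_image_of_mem _ hB')) (Lower.lsup_mono hle)
  · rintro ⟨t, hat, t', htt, ht'⟩
    obtain ⟨a', haa, hat'⟩ := r.left.1 hat
    obtain ⟨a'', haa', hat''⟩ := r.left.1 hat'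
    have h : ∀ B ∈ Upper.rep V, ∃ A : Lower S, a'' ≤ Lower.lsup A ∧ (Lower.map r).rel A B :=
      fun B hB => hr.join.exists_le_lsup
        (r.right.2 ⟨t, prec_trans htt (ht' B (Upper.mem_of_rep hB)), hat''⟩)
    obtain ⟨U, hU, hU'⟩ := exists_finset_choice _ h
    refine ⟨Upper.mk U, ⟨a', haa, fun A hA => ?_⟩, Upper.map_iff.2 fun B hB => ?_⟩
    · obtain ⟨A', hA', hle⟩ := Upper.mem_mk.1 hA
      obtain ⟨_, _, h, -⟩ := hU' A' hA'
      exact prec_le haa' (h.trans (Lower.lsup_mono hle))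
    · obtain ⟨B', hB', hle⟩ := Upper.mem_iff.1 hB
      obtain ⟨A, hA, -, h⟩ := hU B' hB'
      exact ⟨A, Upper.mem_mk_of hA, (Lower.map r).up h hle⟩

/-- Each clause is read off from the square at a test expression: `{∅}` for the least element, `{{b,
c}}` for binary joins, `∅` for totality and `{{b}, {c}}` for binary meets. -/
theorem ApproxRel.isProximityRel_of_comp_locRel [IsStrong S] [IsStrong T] {r : ApproxRel S T}
    (h : (locRel S).comp (Upper.map (Lower.map r)) = r.comp (locRel T)) : r.IsProximityRel := by
  classical
  have h' : ∀ a V, ((locRel S).comp (Upper.map (Lower.map r))).rel a V ↔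
      (r.comp (locRel T)).rel a V := fun a V => by rw [h]
  have hsup : ∀ a B, r.rel a (Lower.lsup B) → ∃ A : Lower S, a ≺ Lower.lsup A ∧
      ∀ c, Lower.Mem c A → ∃ b, Lower.Mem b B ∧ r.rel c b := by
    intro a B hab
    obtain ⟨t, ht, hat⟩ := r.right.1 hab
    obtain ⟨U, hU, hUB⟩ := (h' a (Upper.mk {B})).2 ⟨t, hat, locRel_sing.2 ht⟩
    obtain ⟨A, hA, hAB⟩ := Double.map_iff.1 hUB B (Upper.mem_sing.2 le_rfl)
    exact ⟨A, locRel_sing.1 ((locRel S).up hU hA), hAB⟩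
  refine ⟨⟨?_, ?_⟩, ?_, ?_⟩
  · intro a ha
    obtain ⟨A, haA, hA⟩ := hsup a (Lower.mk ∅) (by simpa [Lower.lsup_mk] using ha)
    refine IsStrong.bot a (prec_le haA (Lower.lsup_le.2 fun c hc => ?_))
    obtain ⟨b, hb, -⟩ := hA c hc
    simp [Lower.mem_mk] at hb
  · intro a b c hab
    obtain ⟨A, haA, hA⟩ := hsup a (Lower.mk {b, c}) (by simpa [Lower.lsup_mk] using hab)
    -- The members of `A` related to `e` have a join that is again related to `e`, because a rounded
    -- ideal is closed under finite joins.
    have hmem : ∀ e, r.rel (((Lower.rep A).filter fun x => r.rel x e).sup _root_.id) e := by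
      intro e
      rw [← Lower.lsup_mk]
      refine (r.ideal e).lsup_mem fun x hx => ?_
      obtain ⟨y, hy, hxy⟩ := Lower.mem_mk.1 hx
      exact r.down hxy (Finset.mem_filter.1 hy).2
    have hle : Lower.lsup A ≤ ((Lower.rep A).filter fun x => r.rel x b).sup _root_.id ⊔
        ((Lower.rep A).filter fun x => r.rel x c).sup _root_.id := by
      refine Finset.sup_le fun x hx => ?_
      obtain ⟨e, he, hxe⟩ := hA x (Lower.mem_of_rep hx)
      obtain ⟨e', he', hle⟩ := Lower.mem_mk.1 he
      have hxe' := r.up hxe hle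
      rcases Finset.mem_insert.1 he' with rfl | he'
      · exact (Finset.le_sup (f := _root_.id) (Finset.mem_filter.2 ⟨hx, hxe'⟩)).trans le_sup_left
      · rw [Finset.mem_singleton.1 he'] at hxe'
        exact (Finset.le_sup (f := _root_.id) (Finset.mem_filter.2 ⟨hx, hxe'⟩)).trans le_sup_right
    -- So far `a` is related to the two joins only by `≺`; strength supplies the inequality `≤` with
    -- slightly smaller pieces.
    obtain ⟨b', c', ha, hb, hc⟩ := IsStrong.sup _ _ _ (prec_le haA hle)
    exact ⟨b', c', ha, r.left.2 ⟨_, hb, hmem b⟩, r.left.2 ⟨_, hc, hmem c⟩⟩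
  · intro a a' haa
    obtain ⟨t, hat, -⟩ := (h' a (Upper.mk ∅)).1 ⟨Upper.mk ∅,
      ⟨a', haa, fun A hA => by simp [Upper.mem_mk] at hA⟩,
      Upper.map_iff.2 fun A hA => by simp [Upper.mem_mk] at hA⟩
    exact ⟨t, hat⟩
  · intro a a' b c haa hb hc
    obtain ⟨a₁, h1, h2⟩ := prec_interp haa
    obtain ⟨t, hat, t', htt, ht'⟩ := (h' a (Upper.mk {Lower.mk {b}, Lower.mk {c}})).1
      ⟨Upper.mk {Lower.mk {a'}}, ⟨a₁, h1, fun A hA =>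
        prec_le h2 (Lower.le_lsup (Upper.mem_sing.1 hA))⟩, Double.map_iff.2 fun B hB => by
          refine ⟨Lower.mk {a'}, Upper.mem_sing.2 le_rfl, fun x hx => ?_⟩
          obtain ⟨B', hB', hle⟩ := Upper.mem_mk.1 hB
          rcases Finset.mem_insert.1 hB' with rfl | hB'
          · exact ⟨b, hle, r.down (Lower.mem_sing.1 hx) hb⟩
          · rw [Finset.mem_singleton.1 hB'] at hle
            exact ⟨c, hle, r.down (Lower.mem_sing.1 hx) hc⟩⟩
    refine ⟨t, ⟨prec_trans htt ?_, prec_trans htt ?_⟩, hat⟩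
    · exact Lower.lsup_sing (a := b) ▸ ht' _ (Upper.mem_mk_of (by simp))
    · exact Lower.lsup_sing (a := c) ▸ ht' _ (Upper.mem_mk_of (by simp))

end Semilattice

/-! ### The rounded ideals of a proximity poset -/

/-- The rounded ideals of a proximity poset, ordered by inclusion. -/
def RIdl (S : Type u) [PartialOrder S] [Proximity S] : Type u :=
  {I : Set S // IsRoundedIdeal Proximity.prec I}

namespace RIdl

variable {S : Type u} [PartialOrder S] [Proximity S]

instance : PartialOrder (RIdl S) := inferInstanceAs (PartialOrder
  {I : Set S // IsRoundedIdeal Proximity.prec I})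

instance : Membership S (RIdl S) := ⟨fun I a => a ∈ I.1⟩

/-- The rounded ideal of all elements that approximate `a`. -/
def principal (a : S) : RIdl S := ⟨{b | b ≺ a}, Proximity.prec_ideal a⟩

theorem principal_mono : Monotone (principal (S := S)) := fun _ _ h _ hc => prec_le hc h

theorem principal_le {a : S} {I : RIdl S} (h : a ∈ I) : principal a ≤ I :=
  fun _ hb => I.2.mem_of_prec hb h

theorem exists_prec {a : S} {I : RIdl S} (h : a ∈ I) : ∃ b, a ≺ b ∧ b ∈ I := I.2.exists_prec h

/-- `I ≺ J` if `I` is below `principal x` for some `x ∈ J`. -/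
instance : Proximity (RIdl S) where
  prec I J := ∃ x ∈ J, I ≤ principal x
  prec_ideal J := by
    refine ⟨⟨?_, ?_, ?_⟩, fun I => ⟨?_, ?_⟩⟩
    · rintro I I' h ⟨x, hx, hI⟩
      exact ⟨x, hx, h.trans hI⟩
    · obtain ⟨x, hx⟩ := J.2.1.Nonempty
      exact ⟨principal x, x, hx, le_rfl⟩
    · rintro I ⟨x, hx, hI⟩ I' ⟨y, hy, hI'⟩
      obtain ⟨z, hz, h1, h2⟩ := J.2.1.Directed x hx y hy
      exact ⟨principal z, ⟨z, hz, le_rfl⟩, hI.trans (principal_mono h1),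
        hI'.trans (principal_mono h2)⟩
    · rintro ⟨x, hx, hI⟩
      obtain ⟨y, hxy, hy⟩ := exists_prec hx
      exact ⟨principal y, ⟨x, hxy, hI⟩, y, hy, le_rfl⟩
    · rintro ⟨K, ⟨x, hx, hI⟩, y, hy, hK⟩
      exact ⟨x, principal_le hy (hK hx), hI⟩
  prec_upper I := by
    refine ⟨?_, fun J => ⟨?_, ?_⟩⟩
    · rintro J J' h ⟨x, hx, hI⟩
      exact ⟨x, h hx, hI⟩
    · rintro ⟨x, hx, hI⟩
      obtain ⟨y, hxy, hy⟩ := exists_prec hx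
      exact ⟨principal y, ⟨y, hy, le_rfl⟩, x, hxy, hI⟩
    · rintro ⟨K, ⟨y, hy, hK⟩, x, hx, hI⟩
      exact ⟨x, principal_le hy (hK hx), hI⟩

theorem principal_prec {a : S} {I : RIdl S} (h : a ∈ I) : principal a ≺ I := ⟨a, h, le_rfl⟩

theorem proxMap_principal : ProxMap (principal (S := S)) where
  mono := principal_mono
  prec h := principal_prec h
  cont := by
    rintro I b ⟨x, hx, hI⟩
    obtain ⟨y, hxy, hy⟩ := prec_interp (show x ≺ b from hx)
    exact ⟨y, hy, x, hxy, hI⟩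

/-- Membership as an approximable relation. -/
def memRel (S : Type u) [PartialOrder S] [Proximity S] : ApproxRel S (RIdl S) where
  rel a I := a ∈ I
  ideal I := I.2
  upper a := by
    refine ⟨fun I J h ha => h ha, fun I => ⟨fun ha => ?_, ?_⟩⟩
    · obtain ⟨b, hab, hb⟩ := exists_prec ha
      exact ⟨principal b, principal_prec hb, hab⟩
    · rintro ⟨J, ⟨x, hx, hJ⟩, ha⟩
      exact I.2.mem_of_prec (hJ ha) hx

/-- Together with `comp_memRel` this makes `S` isomorphic in `PxPos` to its poset of rounded ideals,
so the passage to a carrier with joins loses nothing. -/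
theorem memRel_comp : (memRel S).comp (ApproxRel.ofMap principal proxMap_principal) =
    ApproxRel.id S :=
  ApproxRel.ext_iff_rel fun _ _ => ApproxRel.comp_ofMap_rel

theorem comp_memRel : (ApproxRel.ofMap principal proxMap_principal).comp (memRel S) =
    ApproxRel.id (RIdl S) := by
  refine ApproxRel.ext_iff_rel fun I J => ⟨?_, ?_⟩
  · rintro ⟨a, ⟨x, hx, hI⟩, ha⟩
    exact ⟨x, J.2.mem_of_prec hx ha, hI⟩
  · rintro ⟨x, hx, hI⟩
    obtain ⟨y, hxy, hy⟩ := exists_prec hx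
    exact ⟨y, ⟨x, hxy, hI⟩, hy⟩

open Classical in
/-- The join of two rounded ideals of the carrier of a coalgebra. -/
def sup (α : ApproxRel S (Upper (Lower S))) (I J : RIdl S) : RIdl S where
  -- The coalgebra evaluates `x ∨ y` as the ideal of elements related to `{{x, y}}`; these ideals
  -- form a directed union as `x` and `y` vary.
  val := {a | ∃ x ∈ I, ∃ y ∈ J, α.rel a (Upper.mk {Lower.mk {x, y}})}
  property := by
    refine ⟨⟨?_, ?_, ?_⟩, fun a => ⟨?_, ?_⟩⟩
    · rintro b a h ⟨x, hx, y, hy, hb⟩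
      exact ⟨x, hx, y, hy, α.down h hb⟩
    · obtain ⟨x, hx⟩ := I.2.1.Nonempty
      obtain ⟨y, hy⟩ := J.2.1.Nonempty
      obtain ⟨a, ha⟩ := α.inhabited (Upper.mk {Lower.mk {x, y}})
      exact ⟨a, x, hx, y, hy, ha⟩
    · rintro a ⟨x, hx, y, hy, ha⟩ b ⟨x', hx', y', hy', hb⟩
      obtain ⟨x₁, hx₁, h1, h2⟩ := I.2.1.Directed x hx x' hx'
      obtain ⟨y₁, hy₁, h3, h4⟩ := J.2.1.Directed y hy y' hy'
      have hle : ∀ {x y : S}, x ≤ x₁ → y ≤ y₁ →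
          Upper.mk {Lower.mk {x, y}} ≤ Upper.mk {Lower.mk {x₁, y₁}} := fun h h' =>
        Upper.sing_mono (Lower.mk_le_mk.2 (by simp [lowerExt, h, h']))
      obtain ⟨c, hc, hac, hbc⟩ := α.directed (α.up ha (hle h1 h3)) (α.up hb (hle h2 h4))
      exact ⟨c, ⟨x₁, hx₁, y₁, hy₁, hc⟩, hac, hbc⟩
    · rintro ⟨x, hx, y, hy, ha⟩
      obtain ⟨b, hab, hb⟩ := α.left.1 ha
      exact ⟨b, hab, x, hx, y, hy, hb⟩
    · rintro ⟨b, hab, x, hx, y, hy, hb⟩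
      exact ⟨x, hx, y, hy, α.left.2 ⟨b, hab, hb⟩⟩

/-! ### Finite joins of rounded ideals -/

section Coalgebra

variable {α : ApproxRel S (Upper (Lower S))}

-- The least-ideal property for a two-element formal join. Only the approximants of `x` and `y` have
-- to lie in `K`, so it also applies when `K` is the join of the principal ideals of `x` and `y`.
open Classical in
theorem mem_of_rel_pair (hα : Double.IsCoalg α) {a x y : S} {K : RIdl S} (hx : principal x ≤ K)
    (hy : principal y ≤ K)
    (h : α.rel a (Upper.mk {Lower.mk {x, y}})) : a ∈ K := by
  refine hα.mem_of_rel_sing K.2 (fun c hc d hd => ?_) h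
  obtain ⟨e, he, hce⟩ := Lower.mem_mk.1 hc
  rcases Finset.mem_insert.1 he with rfl | he
  · exact hx (prec_le hd hce)
  · rw [Finset.mem_singleton.1 he] at hce
    exact hy (prec_le hd hce)

/-- The join-semilattice of rounded ideals of the carrier of a coalgebra. -/
abbrev semilatticeSup (hα : Double.IsCoalg α) : SemilatticeSup (RIdl S) where
  -- The order remains inclusion, so the proximity on `RIdl S` fits this semilattice.
  toPartialOrder := inferInstance
  sup := sup α
  le_sup_left I J a ha := by
    obtain ⟨x, hax, hx⟩ := exists_prec ha
    obtain ⟨y, hy⟩ := J.2.1.Nonempty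
    exact ⟨x, hx, y, hy, hα.rel_of_mem (Lower.mem_mk_of (by simp)) hax⟩
  le_sup_right I J a ha := by
    obtain ⟨y, hay, hy⟩ := exists_prec ha
    obtain ⟨x, hx⟩ := I.2.1.Nonempty
    exact ⟨x, hx, y, hy, hα.rel_of_mem (Lower.mem_mk_of (by simp)) hay⟩
  sup_le I J K hI hJ a := by
    rintro ⟨x, hx, y, hy, ha⟩
    exact mem_of_rel_pair hα ((principal_le hx).trans hI) ((principal_le hy).trans hJ) ha

/-- The least rounded ideal of the carrier of a coalgebra. -/
abbrev orderBot (hα : Double.IsCoalg α) : OrderBot (RIdl S) where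
  bot := ⟨{a | α.rel a (Upper.mk {Lower.mk ∅})}, α.ideal _⟩
  bot_le I a ha := hα.mem_of_rel_sing I.2 (fun c hc => by simp [Lower.mem_mk] at hc) ha

/-- `I ≺ J ⊔ K` passes through a single element `w` of the join, and `w` comes from one pair `x ∈
J`, `y ∈ K`; the principal ideals of `x` and `y` are the required pieces. -/
theorem isStrong (hα : Double.IsCoalg α) :
    @IsStrong (RIdl S) (semilatticeSup hα) (orderBot hα) inferInstance := by
  let := semilatticeSup hα
  let := orderBot hα
  refine ⟨?_, ?_⟩
  · rintro I ⟨x, hx, hI⟩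
    exact le_bot_iff.1 (hI.trans (principal_le hx))
  · rintro I J K ⟨w, ⟨x, hx, y, hy, hw⟩, hI⟩
    refine ⟨principal x, principal y, hI.trans (principal_le ?_), principal_prec hx,
      principal_prec hy⟩
    exact mem_of_rel_pair hα le_sup_left le_sup_right hw

end Coalgebra

end RIdl

/-! ### The equivalence of categories -/

/-- Conjugation by an isomorphism preserves both laws by naturality of `ε` and `δ`. -/
theorem IsCoalgebraStructure.of_iso {C : Type u} [Category.{v} C] {G : Comonad C} {X Y : C}
    {α : X ⟶ G.obj X} (hα : IsCoalgebraStructure G X α) (e : X ≅ Y) :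
    IsCoalgebraStructure G Y (e.inv ≫ α ≫ G.map e.hom) where
  counit := by
    have h := G.ε.naturality e.hom
    simp only [Functor.id_map] at h
    simp only [Category.assoc, h]
    rw [← Category.assoc α]
    erw [hα.counit]
    simp
  coassoc := by
    simp only [Category.assoc, Functor.map_comp]
    have h := G.δ.naturality e.hom
    simp only [Functor.comp_map] at h
    rw [h, ← Category.assoc α, hα.coassoc, ← G.map_comp_assoc e.hom]
    simp

/-- The isomorphism between a proximity poset and the proximity poset of its rounded ideals. -/
def RIdl.iso (X : PxPos.{u}) : X ≅ PxPos.mk (RIdl X.carrier) where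
  hom := RIdl.memRel X.carrier
  inv := ApproxRel.ofMap RIdl.principal RIdl.proxMap_principal
  hom_inv_id := RIdl.memRel_comp
  inv_hom_id := RIdl.comp_memRel

/-- The functor that sends a localized strong proximity join-semilattice to its coalgebra. -/
def toCoalgebra : LSPxJLat.{u} ⥤ Comonad.Coalgebra doublePowerlocale.{u} where
  obj S :=
    { A := PxPos.mk S.carrier
      a := locRel S.carrier
      counit := ((Double.isCoalgebraStructure_iff _).2 Double.isCoalg_locRel).counit
      coassoc := ((Double.isCoalgebraStructure_iff _).2 Double.isCoalg_locRel).coassoc }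
  map r :=
    { f := r.1
      h := r.2.comp_locRel }
  map_id _ := rfl
  map_comp _ _ := rfl

instance : toCoalgebra.{u}.Faithful where
  map_injective h := Subtype.ext (congrArg Comonad.Coalgebra.Hom.f h)

instance : toCoalgebra.{u}.Full where
  map_surjective f := ⟨⟨f.f, ApproxRel.isProximityRel_of_comp_locRel f.h⟩, rfl⟩

instance : toCoalgebra.{u}.EssSurj where
  mem_essImage X := by
    have hX : IsCoalgebraStructure doublePowerlocale X.A X.a := ⟨X.counit, X.coassoc⟩
    have hα := (Double.isCoalgebraStructure_iff (S := X.A.carrier) X.a).1 hX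
    let := RIdl.semilatticeSup hα
    let := RIdl.orderBot hα
    have := RIdl.isStrong hα
    have hβ := (Double.isCoalgebraStructure_iff (S := RIdl X.A.carrier) _).1
      (hX.of_iso (RIdl.iso X.A))
    -- Localization of the rounded ideals comes from the transported structure; only then is
    -- `locRel` known to be a coalgebra, and uniqueness identifies the two.
    have := hβ.isLocalized
    have h := hβ.unique Double.isCoalg_locRel
    refine ⟨LSPxJLat.mk (RIdl X.A.carrier), ⟨(Comonad.Coalgebra.isoMk (RIdl.iso X.A) ?_).symm⟩⟩
    -- The isomorphism is a homomorphism to the transported structure by construction, hence to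
    -- `locRel`.
    refine Eq.trans ?_ (congrArg (fun r => (RIdl.iso X.A).hom ≫ r) h)
    exact ((RIdl.iso X.A).hom_inv_id_assoc _).symm

instance : toCoalgebra.{u}.IsEquivalence where

end Prox

theorem mainTheorem4 :
    Nonempty (Prox.LSPxJLat.{u} ≌ Comonad.Coalgebra Prox.doublePowerlocale.{u}) ∧
    ∀ (S : Type u) [SemilatticeSup S] [OrderBot S] [Prox.Proximity S] [Prox.IsStrong S],
      Prox.IsLocalized S ↔
        ∃ α : Prox.PxPos.mk S ⟶ Prox.doublePowerlocale.obj (Prox.PxPos.mk S),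
          Prox.IsCoalgebraStructure Prox.doublePowerlocale (Prox.PxPos.mk S) α := by
  refine ⟨⟨Prox.toCoalgebra.asEquivalence⟩, fun S _ _ _ _ => ⟨fun _ => ?_, ?_⟩⟩
  · exact ⟨Prox.locRel S, (Prox.Double.isCoalgebraStructure_iff _).2 Prox.Double.isCoalg_locRel⟩
  · rintro ⟨α, hα⟩
    exact ((Prox.Double.isCoalgebraStructure_iff (S := S) α).1 hα).isLocalized
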